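/- Let $\Bbbk$ be a field, or more generally a nonzero commutative ring (for instance $\mathbb Z$), and let $L\subseteq\mathbb R^n$ be a linear subspace of dimension at least $2$ that is not contained in any coordinate hyperplane $\{x_i=0\}$. Let $\mathbb P=\{v\in\mathbb R^n: v_i>0 \text{ for all } i\}$. Notation. Let $S^{n-1}\subseteq\mathbb R^n$ be the Euclidean unit sphere. For a partial function $\mathsf p$ from $\{1,\dots,n\}$ to $\{-1,1\}$ let $\triangle_{\mathsf p}$ (respectively $\mathring\triangle_{\mathsf p}$) be the set of $x\in S^{n-1}$ with $\mathsf p(i)x_i\ge 0$ (respectively $>0$) for $i\in\operatorname{dom}\mathsf p$ and $x_i=0$ for $i\notin\operatorname{dom}\mathsf p$. Write $\mathbf 1$ for the constant function $1$. For a total sign pattern $f$ and a partial function $\mathsf p\subseteq f$ let $f\Diamond\mathsf p$ be the total sign pattern that equals $f$ on $\operatorname{dom}\mathsf p$ and $-f$ off it. Let $\bigstar(f,\mathsf p)$ be the union of the open cells $\mathring\triangle_{\mathsf q}$ with $\mathsf p\subseteq\mathsf q\subseteq f\Diamond\mathsf p$, and let $$\widetilde\partial\bigstar(f,\mathsf p)=\overline{\bigstar(f,\mathsf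 p)}\setminus\bigstar(f,\mathsf p)=\bigcup_{i\in\operatorname{dom}\mathsf p}\triangle_{(f\Diamond\mathsf p)\setminus\{i\mapsto \mathsf p(i)\}} .$$ For $g:\{1,\dots,n\}\to\{-1,1\}$ let $\mathbf 1\cap g$ be the restriction of $\mathbf 1$ to $\{i:g(i)=1\}$ and put $$\Xi(g)=\widetilde\partial\bigstar_L(\mathbf 1,\mathbf 1\cap g):=L\cap\widetilde\partial\bigstar(\mathbf 1,\mathbf 1\cap g),$$ that is, the set of $x\in L\cap\triangle_g$ such that $x_i=0$ for some $i$ with $g(i)=1$, with the subspace topology. Theorem (Homological Farkas). The following are equivalent: 1. $L\cap\mathbb P\neq\varnothing$. 2. For every $g:\{1,\dots,n\}\to\{-1,1\}$ with $g\ne\mathbf 1$, $g\neq-\mathbf 1$ and $\triangle_g\cap L\neq\varnothing$, the reduced singular cohomology $\widetilde H^{j}(\Xi(g);\Bbbk)$ vanishes for every integer $j\ge -1$. Here $\widetilde H^\bullet$ is the cohomology of the augmented singular cochain complex, so that $\widetilde H^{-1}(\varnothing;\Bbbk)=\Bbbk\ne0$; in particular, condition 2 requires $\Xi(g)\ne\varnothing$.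 -/

import Mathlib

/-! ### Reduced singular cohomology

A singular `(q - 1)`-simplex of `X` is a continuous map `stdSimplex ℝ (Fin q) → X`, where `Fin q`
indexes the `q` vertices.  For `q = 0` the standard simplex is empty and there is exactly one such
map, so that the cochain complex below, which starts at `q = 0`, is the usual augmented singular
cochain complex of `X`, with `q` sitting in cohomological degree `q - 1`. -/

/-- Singular simplices with `q` vertices, that is, of dimension `q - 1`. -/
abbrev SingularSimplex (X : Type*) [TopologicalSpace X] (q : ℕ) : Type _ :=
  C(stdSimplex ℝ (Fin q), X)

/-- The face of a singular simplex opposite to the vertex `i`. -/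
noncomputable def SingularSimplex.face {X : Type*} [TopologicalSpace X] {q : ℕ}
    (σ : SingularSimplex X (q + 1)) (i : Fin (q + 1)) : SingularSimplex X q :=
  ContinuousMap.comp σ ⟨stdSimplex.map i.succAbove, stdSimplex.continuous_map _⟩

/-- Singular cochains of degree `q - 1` with coefficients in `k` (augmented in degree `-1`). -/
abbrev SingularCochain (k X : Type*) [TopologicalSpace X] (q : ℕ) : Type _ :=
  SingularSimplex X q → k

/-- The coboundary `(δ φ)(σ) = ∑ i, (-1) ^ i φ(face i of σ)`, from degree `q - 1` to degree `q`. -/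
noncomputable def singularCoboundary (k X : Type*) [CommRing k] [TopologicalSpace X] (q : ℕ) :
    SingularCochain k X q →ₗ[k] SingularCochain k X (q + 1) where
  toFun φ := fun σ => ∑ i : Fin (q + 1), (-1 : k) ^ (i : ℕ) * φ (σ.face i)
  map_add' φ ψ := by
    funext σ
    simp [mul_add, Finset.sum_add_distrib]
  map_smul' c φ := by
    funext σ
    simp [Finset.mul_sum, mul_left_comm]

/-- Cocycles of degree `q - 1` of the augmented singular cochain complex. -/
noncomputable def reducedCocycles (k X : Type*) [CommRing k] [TopologicalSpace X] (q : ℕ) :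
    Submodule k (SingularCochain k X q) :=
  LinearMap.ker (singularCoboundary k X q)

/-- Coboundaries of degree `q - 1` of the augmented singular cochain complex. -/
noncomputable def reducedCoboundaries (k X : Type*) [CommRing k] [TopologicalSpace X] :
    (q : ℕ) → Submodule k (SingularCochain k X q)
  | 0 => ⊥
  | q + 1 => LinearMap.range (singularCoboundary k X q)

/-- `ReducedCohomology k X q` is the reduced singular cohomology `H̃^(q - 1)(X; k)`. -/
abbrev ReducedCohomology (k X : Type*) [CommRing k] [TopologicalSpace X] (q : ℕ) : Type _ :=
  reducedCocycles k X q ⧸ (reducedCoboundaries k X q).submoduleOf (reducedCocycles k X q)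

theorem SingularSimplex.face_face {X : Type*} [TopologicalSpace X] {q : ℕ}
    (σ : SingularSimplex X (q + 2)) (i : Fin (q + 1)) (j : Fin (q + 2))
    (h : (j : ℕ) ≤ i) :
    (σ.face j).face i = (σ.face i.succ).face (j.castLT (lt_of_le_of_lt h i.isLt)) := by
  have key : j.succAbove ∘ i.succAbove =
      i.succ.succAbove ∘ (j.castLT (lt_of_le_of_lt h i.isLt)).succAbove := by
    funext a
    apply Fin.ext
    simp only [Function.comp_apply, Fin.succAbove, Fin.lt_def]
    split_ifs <;> simp_all <;> omega
  ext x
  simp only [SingularSimplex.face, ContinuousMap.comp_apply, ContinuousMap.coe_mk,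
    stdSimplex.map_comp_apply, key]

theorem singularCoboundary_comp (k X : Type*) [CommRing k] [TopologicalSpace X] (q : ℕ) :
    singularCoboundary k X (q + 1) ∘ₗ singularCoboundary k X q = 0 := by
  ext φ σ
  simp only [LinearMap.comp_apply, singularCoboundary, LinearMap.coe_mk, AddHom.coe_mk,
    LinearMap.zero_apply, Pi.zero_apply, Finset.mul_sum]
  rw [← Finset.sum_product', Finset.univ_product_univ]
  set F : Fin (q + 2) × Fin (q + 1) → k := fun p =>
    (-1) ^ (p.1 : ℕ) * ((-1) ^ (p.2 : ℕ) * φ ((σ.face p.1).face p.2)) with hF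
  change ∑ p, F p = 0
  let S : Finset (Fin (q + 2) × Fin (q + 1)) := {p | (p.1 : ℕ) ≤ p.2}
  rw [← Finset.sum_add_sum_compl S, ← eq_neg_iff_add_eq_zero, ← Finset.sum_neg_distrib]
  refine Finset.sum_bij
    (fun p hp => (p.2.succ, p.1.castLT (lt_of_le_of_lt (Finset.mem_filter.mp hp).2 p.2.isLt)))
    ?_ ?_ ?_ ?_
  · rintro ⟨j, i⟩ hp
    simp only [S, Finset.mem_filter, Finset.mem_univ, true_and] at hp
    simp only [S, Finset.mem_compl, Finset.mem_filter, Finset.mem_univ, true_and, not_le,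
      Fin.val_succ, Fin.val_castLT]
    omega
  · rintro ⟨j, i⟩ hp ⟨j', i'⟩ hp' h
    simp only [Prod.mk.injEq, Fin.ext_iff, Fin.val_succ, Fin.val_castLT] at h ⊢
    omega
  · rintro ⟨j, i⟩ hp
    simp only [S, Finset.mem_compl, Finset.mem_filter, Finset.mem_univ, true_and, not_le] at hp
    refine ⟨(i.castSucc, ⟨j - 1, by omega⟩), ?_, ?_⟩
    · simp only [S, Finset.mem_filter, Finset.mem_univ, true_and, Fin.val_castSucc]
      omega
    · simp only [Prod.mk.injEq, Fin.ext_iff, Fin.val_succ, Fin.val_castLT, Fin.val_castSucc]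
      exact ⟨Nat.sub_add_cancel (Nat.one_le_of_lt hp), trivial⟩
  · rintro ⟨j, i⟩ hp
    simp only [S, Finset.mem_filter, Finset.mem_univ, true_and] at hp
    simp only [hF, σ.face_face i j hp, Fin.val_succ, Fin.val_castLT, pow_succ]
    ring

theorem reducedCoboundaries_le (k X : Type*) [CommRing k] [TopologicalSpace X] (q : ℕ) :
    reducedCoboundaries k X q ≤ reducedCocycles k X q := by
  cases q with
  | zero => exact bot_le
  | succ q =>
    rintro _ ⟨φ, rfl⟩
    exact LinearMap.congr_fun (singularCoboundary_comp k X q) φ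

/-! ### The sphere cut by the coordinate hyperplanes

Sign patterns are functions `Fin n → ℤˣ`, with values in `{-1, 1}`; partial sign patterns are
functions `Fin n → Option ℤˣ`, with `none` where the pattern is undefined. -/

/-- A sign pattern, viewed as a partial sign pattern. -/
def SignPattern.toPartial {n : ℕ} (g : Fin n → ℤˣ) : Fin n → Option ℤˣ := fun i => some (g i)

/-- The partial sign pattern `f ∩ g`: the common value where `f` and `g` agree, undefined
elsewhere. -/
def SignPattern.inter {n : ℕ} (f g : Fin n → ℤˣ) : Fin n → Option ℤˣ :=
  fun i => if f i = g i then some (f i) else none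

/-- The sign pattern `f ◇ p`, for `p ⊆ f`: it agrees with `f` on the domain of `p` and with `-f`
off it. -/
def SignPattern.flip {n : ℕ} (f : Fin n → ℤˣ) (p : Fin n → Option ℤˣ) : Fin n → ℤˣ :=
  fun i => (p i).getD (-f i)

/-- `p ⊆ p'` for partial sign patterns: `p'` extends `p`. -/
def SignPattern.Subpattern {n : ℕ} (p p' : Fin n → Option ℤˣ) : Prop :=
  ∀ i, ∀ s, p i = some s → p' i = some s

/-- The open cell of the unit sphere with label `p`: the unit vectors whose `i`-th coordinate
has sign `p i` if `p i` is defined and is zero otherwise. -/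
def openCell {n : ℕ} (p : Fin n → Option ℤˣ) : Set (EuclideanSpace ℝ (Fin n)) :=
  {x | ‖x‖ = 1 ∧ ∀ i, (∀ s, p i = some s → 0 < ((s : ℤ) : ℝ) * x i) ∧ (p i = none → x i = 0)}

/-- The closed cell of the unit sphere with label `p`. -/
def closedCell {n : ℕ} (p : Fin n → Option ℤˣ) : Set (EuclideanSpace ℝ (Fin n)) :=
  {x | ‖x‖ = 1 ∧ ∀ i, (∀ s, p i = some s → 0 ≤ ((s : ℤ) : ℝ) * x i) ∧ (p i = none → x i = 0)}

/-- The star `★(f, p)`: the union of the open cells with label between `p` and `f ◇ p`. -/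
def signStar {n : ℕ} (f : Fin n → ℤˣ) (p : Fin n → Option ℤˣ) :
    Set (EuclideanSpace ℝ (Fin n)) :=
  {x | ∃ q : Fin n → Option ℤˣ, SignPattern.Subpattern p q ∧
    SignPattern.Subpattern q (SignPattern.toPartial (SignPattern.flip f p)) ∧ x ∈ openCell q}

/-- The partial boundary `∂̃★(f, p)`: the union, over `i` in the domain of `p`, of the closed cells
whose label is `f ◇ p` made undefined at `i`. By `closure_signStar_diff`, it is the closure of
the star minus the star. -/
def starBoundary {n : ℕ} (f : Fin n → ℤˣ) (p : Fin n → Option ℤˣ) :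
    Set (EuclideanSpace ℝ (Fin n)) :=
  {x | ∃ i, p i ≠ none ∧
    x ∈ closedCell (Function.update (SignPattern.toPartial (SignPattern.flip f p)) i none)}

/-- The space `Ξ(g) = ∂̃★_L(1, 1 ∩ g) = ∂̃★(1, 1 ∩ g) ∩ L`. -/
def farkasSpace {n : ℕ} (L : Submodule ℝ (EuclideanSpace ℝ (Fin n))) (g : Fin n → ℤˣ) :
    Set (EuclideanSpace ℝ (Fin n)) :=
  starBoundary 1 (SignPattern.inter 1 g) ∩ (L : Set (EuclideanSpace ℝ (Fin n)))

theorem mem_closedCell_toPartial {n : ℕ} (g : Fin n → ℤˣ) (x : EuclideanSpace ℝ (Fin n)) :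
    x ∈ closedCell (SignPattern.toPartial g) ↔
      ‖x‖ = 1 ∧ ∀ i, 0 ≤ ((g i : ℤ) : ℝ) * x i := by
  simp [closedCell, SignPattern.toPartial]

theorem mem_starBoundary {n : ℕ} (f : Fin n → ℤˣ) (p : Fin n → Option ℤˣ)
    (x : EuclideanSpace ℝ (Fin n)) :
    x ∈ starBoundary f p ↔
      x ∈ closedCell (SignPattern.toPartial (SignPattern.flip f p)) ∧
        ∃ i, p i ≠ none ∧ x i = 0 := by
  constructor
  · rintro ⟨i, hi, hx, h⟩
    have hxi : x i = 0 := (h i).2 (by simp)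
    refine ⟨(mem_closedCell_toPartial _ x).2 ⟨hx, fun j => ?_⟩, i, hi, hxi⟩
    by_cases hj : j = i
    · subst hj
      simp [hxi]
    · exact (h j).1 _ (by simp [Function.update_of_ne hj, SignPattern.toPartial])
  · rintro ⟨hx, i, hi, hxi⟩
    obtain ⟨hx, h⟩ := (mem_closedCell_toPartial _ x).1 hx
    refine ⟨i, hi, hx, fun j => ?_⟩
    by_cases hj : j = i
    · subst hj
      simp [hxi]
    · simpa [Function.update_of_ne hj, SignPattern.toPartial] using h j

theorem mem_signStar {n : ℕ} (f : Fin n → ℤˣ) (p : Fin n → Option ℤˣ)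
    (x : EuclideanSpace ℝ (Fin n)) :
    x ∈ signStar f p ↔
      x ∈ closedCell (SignPattern.toPartial (SignPattern.flip f p)) ∧
        ∀ i, p i ≠ none → x i ≠ 0 := by
  rw [mem_closedCell_toPartial]
  constructor
  · rintro ⟨q, hpq, hq, hx, h⟩
    refine ⟨⟨hx, fun i => ?_⟩, fun i hi hxi => ?_⟩
    · cases hqi : q i with
      | none => simp [(h i).2 hqi]
      | some s =>
        have hs : some (SignPattern.flip f p i) = some s := hq i s hqi
        rw [Option.some_inj.1 hs]
        exact ((h i).1 s hqi).le
    · obtain ⟨s, hs⟩ := Option.ne_none_iff_exists'.1 hi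
      have := (h i).1 s (hpq i s hs)
      simp [hxi] at this
  · rintro ⟨⟨hx, h⟩, hp⟩
    refine ⟨fun i => if x i = 0 then none else some (SignPattern.flip f p i), ?_, ?_, hx, ?_⟩
    · intro i s hs
      have : x i ≠ 0 := hp i (by simp [hs])
      simp [this, SignPattern.flip, hs]
    · intro i s hs
      by_cases hxi : x i = 0
      · simp [hxi] at hs
      · simpa [hxi, SignPattern.toPartial] using hs
    · intro i
      by_cases hxi : x i = 0
      · simp [hxi]
      · refine ⟨fun s hs => ?_, fun hs => by simp [hxi] at hs⟩
        have hs' : SignPattern.flip f p i = s := by simpa [hxi] using hs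
        subst hs'
        exact lt_of_le_of_ne (h i) (Ne.symm (mul_ne_zero (by simp) hxi))

/-- The closure of a star is the closed cell of its largest label. -/
theorem closure_signStar {n : ℕ} (f : Fin n → ℤˣ) (p : Fin n → Option ℤˣ) :
    closure (signStar f p) =
      closedCell (SignPattern.toPartial (SignPattern.flip f p)) := by
  set g := SignPattern.flip f p with hg
  apply Set.Subset.antisymm
  · apply closure_minimal
    · intro x hx
      exact ((mem_signStar f p x).1 hx).1
    · have : closedCell (SignPattern.toPartial g) =
          {x : EuclideanSpace ℝ (Fin n) | ‖x‖ = 1} ∩ ⋂ i, {x | 0 ≤ ((g i : ℤ) : ℝ) * x i} := by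
        ext x
        simp [mem_closedCell_toPartial]
      rw [this]
      refine (isClosed_eq continuous_norm continuous_const).inter
        (isClosed_iInter fun i => isClosed_le continuous_const ?_)
      fun_prop
  · intro x hx
    obtain ⟨hx1, hx2⟩ := (mem_closedCell_toPartial g x).1 hx
    let e : EuclideanSpace ℝ (Fin n) := WithLp.toLp 2 fun i => ((g i : ℤ) : ℝ)
    let u : ℝ → EuclideanSpace ℝ (Fin n) := fun t => ‖x + t • e‖⁻¹ • (x + t • e)
    have hcont : ContinuousAt u 0 := by
      have h1 : ContinuousAt (fun t : ℝ => x + t • e) 0 := by fun_prop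
      exact (h1.norm.inv₀ (by simp [hx1])).smul h1
    have hu0 : u 0 = x := by simp [u, hx1]
    have htend : Filter.Tendsto u (nhdsWithin 0 (Set.Ioi 0)) (nhds x) := by
      have := hcont.tendsto
      rw [hu0] at this
      exact this.mono_left nhdsWithin_le_nhds
    refine mem_closure_of_tendsto htend ?_
    filter_upwards [self_mem_nhdsWithin] with t ht
    have ht : 0 < t := ht
    have hpos : ∀ i, 0 < ((g i : ℤ) : ℝ) * (x + t • e) i := by
      intro i
      have hsq : ((g i : ℤ) : ℝ) * ((g i : ℤ) : ℝ) = 1 := by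
        rcases Int.units_eq_one_or (g i) with h | h <;> simp [h]
      have : ((g i : ℤ) : ℝ) * (x + t • e) i
          = ((g i : ℤ) : ℝ) * x i + t * (((g i : ℤ) : ℝ) * ((g i : ℤ) : ℝ)) := by
        simp [e]
        ring
      rw [this, hsq]
      linarith [hx2 i]
    have hne : x + t • e ≠ 0 := by
      intro h0
      have hn : n ≠ 0 := by
        rintro rfl
        have : x = 0 := Subsingleton.elim _ _
        simp [this] at hx1
      have := hpos ⟨0, Nat.pos_of_ne_zero hn⟩
      simp [h0] at this
    have hnorm : 0 < ‖x + t • e‖⁻¹ := inv_pos.2 (norm_pos_iff.2 hne)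
    have hu : ∀ i, 0 < ((g i : ℤ) : ℝ) * u t i := by
      intro i
      have : ((g i : ℤ) : ℝ) * u t i
          = ‖x + t • e‖⁻¹ * (((g i : ℤ) : ℝ) * (x + t • e) i) := by
        simp only [u, PiLp.smul_apply, smul_eq_mul]
        ring
      rw [this]
      exact mul_pos hnorm (hpos i)
    refine (mem_signStar f p _).2 ⟨(mem_closedCell_toPartial _ _).2 ⟨?_, fun i => (hu i).le⟩, ?_⟩
    · simp only [u, norm_smul, norm_inv, norm_norm]
      exact inv_mul_cancel₀ (norm_ne_zero_iff.2 hne)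
    · intro i _ h0
      have := hu i
      simp [h0] at this

/-- The partial boundary of a star is its closure minus the star itself. -/
theorem closure_signStar_diff {n : ℕ} (f : Fin n → ℤˣ) (p : Fin n → Option ℤˣ) :
    closure (signStar f p) \ signStar f p = starBoundary f p := by
  ext x
  rw [closure_signStar, Set.mem_sdiff, mem_signStar, mem_starBoundary]
  push Not
  tauto

/-! If `L` contains a positive vector `v`, let `s` be the set of nonzero vectors of `L` in the
closed orthant of `g`. It is convex, hence acyclic by coning. Sliding `x` along `-v` until the first
coordinate of positive sign vanishes, then normalising, retracts `s` onto Ξ(g), so Ξ(g) is acyclic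
too (`subsingleton_reducedCohomology_farkasSpace`).

Conversely, suppose `L` has no positive vector and choose a chamber of `L` with as many positive
signs as possible. Every boundary point has a vanishing coordinate of positive sign, since otherwise
one could cross into a chamber with more positive signs (`exists_chamber`). Hence Ξ(g) is the whole
boundary of the chamber, topologically a sphere of dimension `dim L - 2`, and its cohomology in that
degree must be shown nonzero.

This is done by an explicit cocycle (`not_subsingleton_reducedCohomology`). Label each point of the
space `X` by the index of a largest linear coordinate. The determinant cochain `faceDet` has
coboundary `labelDet`, which detects tuples carrying all labels. No small simplex carries all
labels, so correcting `faceDet` by subdivision homotopies yields a genuine cocycle (`labelValue`).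
An oriented Sperner lemma (`tupleSubdiv_iterate_labelDet`) shows that its value on the boundary of a
simplex mapped into `X` is 1, whereas a coboundary would give 0. -/

/-! ### Cochains on tuples of points -/

section TupleCochain

variable {k A B : Type*} [CommRing k]

/-- The simplicial coboundary on cochains which are functions of tuples of points. -/
def tupleCoboundary (k A : Type*) [CommRing k] (p : ℕ) :
    ((Fin p → A) → k) →ₗ[k] ((Fin (p + 1) → A) → k) where
  toFun φ := fun v => ∑ i : Fin (p + 1), (-1 : k) ^ (i : ℕ) * φ (v ∘ i.succAbove)
  map_add' φ ψ := by
    funext v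
    simp [mul_add, Finset.sum_add_distrib]
  map_smul' c φ := by
    funext v
    simp [Finset.mul_sum, mul_left_comm]

theorem tupleCoboundary_apply {p : ℕ} (φ : (Fin p → A) → k) (v : Fin (p + 1) → A) :
    tupleCoboundary k A p φ v = ∑ i : Fin (p + 1), (-1 : k) ^ (i : ℕ) * φ (v ∘ i.succAbove) :=
  rfl

/-- Evaluation of a cochain on cones with apex `a`. -/
def coneAt (k : Type*) {A : Type*} [CommRing k] (p : ℕ) (a : A) :
    ((Fin (p + 1) → A) → k) →ₗ[k] ((Fin p → A) → k) where
  toFun φ := fun w => φ (Fin.cons a w)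
  map_add' _ _ := rfl
  map_smul' _ _ := rfl

theorem coneAt_apply {p : ℕ} (a : A) (φ : (Fin (p + 1) → A) → k) (w : Fin p → A) :
    coneAt k p a φ w = φ (Fin.cons a w) := rfl

theorem cons_comp_succ_succAbove {p : ℕ} (a : A) (w : Fin (p + 1) → A) (i : Fin (p + 1)) :
    (Fin.cons a w : Fin (p + 2) → A) ∘ i.succ.succAbove = Fin.cons a (w ∘ i.succAbove) := by
  funext j
  refine Fin.cases ?_ (fun j => ?_) j <;> simp

/-- The face of a cone opposite the apex is its base; the other faces are cones over the faces of
the base, with signs shifted by one. All later identities are inductions on this contraction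
formula. -/
theorem coneAt_tupleCoboundary {p : ℕ} (a : A) (φ : (Fin (p + 1) → A) → k) :
    coneAt k (p + 1) a (tupleCoboundary k A (p + 1) φ) =
      φ - tupleCoboundary k A p (coneAt k p a φ) := by
  funext w
  rw [coneAt_apply, tupleCoboundary_apply, Fin.sum_univ_succ, Pi.sub_apply, tupleCoboundary_apply]
  have h0 : (Fin.cons a w : Fin (p + 2) → A) ∘ Fin.succAbove 0 = w := by
    funext j
    simp
  simp only [cons_comp_succ_succAbove, h0, coneAt_apply, Fin.val_succ, pow_succ]
  simp [Finset.sum_neg_distrib, sub_eq_add_neg]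

theorem tupleCoboundary_tupleCoboundary {p : ℕ} (φ : (Fin p → A) → k) :
    tupleCoboundary k A (p + 1) (tupleCoboundary k A p φ) = 0 := by
  induction p with
  | zero =>
    funext v
    simp [tupleCoboundary_apply, Fin.sum_univ_two, Subsingleton.elim _ (default : Fin 0 → A)]
  | succ p ih =>
    funext v
    obtain ⟨a, w, rfl⟩ : ∃ a w, v = Fin.cons a w := ⟨v 0, Fin.tail v, (Fin.cons_self_tail v).symm⟩
    change coneAt k (p + 2) a (tupleCoboundary k A (p + 2) (tupleCoboundary k A (p + 1) φ)) w = 0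
    rw [coneAt_tupleCoboundary, coneAt_tupleCoboundary, map_sub, ih]
    simp

/-- The dual of the subdivision operator which cones off the subdivided boundary of a tuple `v`
from the point `β v`. -/
def tupleSubdiv (k : Type*) {A : Type*} [CommRing k] (β : ∀ p, (Fin (p + 1) → A) → A) :
    ∀ p, ((Fin p → A) → k) →ₗ[k] ((Fin p → A) → k)
  | 0 => LinearMap.id
  | p + 1 => LinearMap.pi fun v =>
      LinearMap.proj v ∘ₗ tupleCoboundary k A p ∘ₗ tupleSubdiv k β p ∘ₗ coneAt k p (β p v)

/-- The dual of the homotopy between the identity and the subdivision operator. -/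
def tupleHomotopy (k : Type*) {A : Type*} [CommRing k] (β : ∀ p, (Fin (p + 1) → A) → A) :
    ∀ p, ((Fin (p + 1) → A) → k) →ₗ[k] ((Fin p → A) → k)
  | 0 => 0
  | p + 1 => LinearMap.pi fun v =>
      LinearMap.proj v ∘ₗ
        (coneAt k (p + 1) (β p v) -
          tupleCoboundary k A p ∘ₗ tupleHomotopy k β p ∘ₗ coneAt k (p + 1) (β p v))

variable (β : ∀ p, (Fin (p + 1) → A) → A)

theorem tupleSubdiv_zero (φ : (Fin 0 → A) → k) : tupleSubdiv k β 0 φ = φ := rfl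

theorem tupleSubdiv_succ {p : ℕ} (φ : (Fin (p + 1) → A) → k) (v : Fin (p + 1) → A) :
    tupleSubdiv k β (p + 1) φ v =
      tupleCoboundary k A p (tupleSubdiv k β p (coneAt k p (β p v) φ)) v := rfl

theorem tupleHomotopy_zero (φ : (Fin 1 → A) → k) : tupleHomotopy k β 0 φ = 0 := rfl

theorem tupleHomotopy_succ {p : ℕ} (φ : (Fin (p + 2) → A) → k) (v : Fin (p + 1) → A) :
    tupleHomotopy k β (p + 1) φ v =
      coneAt k (p + 1) (β p v) φ v -
        tupleCoboundary k A p (tupleHomotopy k β p (coneAt k (p + 1) (β p v) φ)) v := rfl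

theorem tupleSubdiv_tupleCoboundary {p : ℕ} (φ : (Fin p → A) → k) :
    tupleSubdiv k β (p + 1) (tupleCoboundary k A p φ) =
      tupleCoboundary k A p (tupleSubdiv k β p φ) := by
  induction p with
  | zero =>
    funext v
    rw [tupleSubdiv_succ, tupleSubdiv_zero, tupleSubdiv_zero, tupleCoboundary_apply,
      tupleCoboundary_apply]
    simp only [coneAt_apply, tupleCoboundary_apply]
    simp [Subsingleton.elim _ (default : Fin 0 → A)]
  | succ p ih =>
    funext v
    rw [tupleSubdiv_succ, coneAt_tupleCoboundary, map_sub, ih, map_sub,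
      tupleCoboundary_tupleCoboundary, sub_zero]

/-- Evaluated at `v`, the apex is frozen at `β p v`; the contraction formula then reduces the
identity to the one for the coned cochain, one degree lower. -/
theorem tupleHomotopy_spec {p : ℕ} (φ : (Fin (p + 1) → A) → k) :
    tupleCoboundary k A p (tupleHomotopy k β p φ) +
      tupleHomotopy k β (p + 1) (tupleCoboundary k A (p + 1) φ) =
      φ - tupleSubdiv k β (p + 1) φ := by
  induction p with
  | zero =>
    funext v
    rw [Pi.add_apply, tupleHomotopy_succ, coneAt_tupleCoboundary, tupleHomotopy_zero,
      tupleHomotopy_zero, Pi.sub_apply, Pi.sub_apply, tupleSubdiv_succ, tupleSubdiv_zero]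
    simp
  | succ p ih =>
    funext v
    rw [Pi.add_apply, tupleHomotopy_succ, coneAt_tupleCoboundary, map_sub,
      eq_sub_of_add_eq' (ih (coneAt k (p + 1) (β (p + 1) v) φ)), Pi.sub_apply, Pi.sub_apply,
      tupleSubdiv_succ]
    simp only [map_sub, tupleCoboundary_tupleCoboundary, Pi.sub_apply, Pi.zero_apply]
    ring

/-! ### Naturality under maps compatible with the choice of apexes -/

section Naturality

variable {β} {β' : ∀ p, (Fin (p + 1) → B) → B} {h : A → B}

theorem tupleCoboundary_comp {p : ℕ} (φ : (Fin p → B) → k) (v : Fin (p + 1) → A) :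
    tupleCoboundary k A p (fun w => φ (h ∘ w)) v = tupleCoboundary k B p φ (h ∘ v) := rfl

theorem coneAt_comp {p : ℕ} (φ : (Fin (p + 1) → B) → k) (a : A) :
    coneAt k p a (fun w => φ (h ∘ w)) = fun w => coneAt k p (h a) φ (h ∘ w) := by
  funext w
  simp only [coneAt_apply]
  congr 1
  funext j
  refine Fin.cases ?_ (fun j => ?_) j <;> simp

theorem tupleSubdiv_comp (hβ : ∀ p v, h (β p v) = β' p (h ∘ v)) {p : ℕ}
    (φ : (Fin p → B) → k) :
    tupleSubdiv k β p (fun w => φ (h ∘ w)) = fun v => tupleSubdiv k β' p φ (h ∘ v) := by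
  induction p with
  | zero => rfl
  | succ p ih =>
    funext v
    rw [tupleSubdiv_succ, coneAt_comp, ih, tupleCoboundary_comp, tupleSubdiv_succ, hβ]

theorem tupleSubdiv_iterate_comp (hβ : ∀ p v, h (β p v) = β' p (h ∘ v)) {p : ℕ}
    (φ : (Fin p → B) → k) (N : ℕ) :
    (tupleSubdiv k β p)^[N] (fun w => φ (h ∘ w)) =
      fun v => (tupleSubdiv k β' p)^[N] φ (h ∘ v) := by
  induction N generalizing φ with
  | zero => rfl
  | succ N ih => rw [Function.iterate_succ_apply, tupleSubdiv_comp hβ, ih]; rfl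

theorem tupleHomotopy_comp (hβ : ∀ p v, h (β p v) = β' p (h ∘ v)) {p : ℕ}
    (φ : (Fin (p + 1) → B) → k) :
    tupleHomotopy k β p (fun w => φ (h ∘ w)) = fun v => tupleHomotopy k β' p φ (h ∘ v) := by
  induction p with
  | zero => rfl
  | succ p ih =>
    funext v
    rw [tupleHomotopy_succ, coneAt_comp, ih, tupleCoboundary_comp, tupleHomotopy_succ, hβ]

end Naturality

/-- A cochain differing from `φ` by iterated homotopies, whose coboundary is the `M`-fold
subdivision of the coboundary of `φ`. -/
def tupleCorrection {p : ℕ} (M : ℕ) (φ : (Fin p → A) → k) : (Fin p → A) → k :=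
  φ - ∑ N ∈ Finset.range M,
    tupleHomotopy k β p ((tupleSubdiv k β (p + 1))^[N] (tupleCoboundary k A p φ))

theorem tupleSubdiv_iterate_tupleCoboundary {p : ℕ} (N : ℕ) (φ : (Fin p → A) → k) :
    (tupleSubdiv k β (p + 1))^[N] (tupleCoboundary k A p φ) =
      tupleCoboundary k A p ((tupleSubdiv k β p)^[N] φ) := by
  induction N generalizing φ with
  | zero => rfl
  | succ N ih => rw [Function.iterate_succ_apply, tupleSubdiv_tupleCoboundary, ih]; rfl

/-- Each subdivision of the coboundary of `φ` is closed, so the homotopy formula turns the `N`-th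
summand into the difference of the `N`-th and next subdivisions, and the sum telescopes. -/
theorem tupleCoboundary_tupleCorrection {p : ℕ} (M : ℕ) (φ : (Fin p → A) → k) :
    tupleCoboundary k A p (tupleCorrection β M φ) =
      (tupleSubdiv k β (p + 1))^[M] (tupleCoboundary k A p φ) := by
  induction M with
  | zero => simp [tupleCorrection]
  | succ M ih =>
    have hM : tupleCorrection β (M + 1) φ = tupleCorrection β M φ -
        tupleHomotopy k β p ((tupleSubdiv k β (p + 1))^[M] (tupleCoboundary k A p φ)) := by
      rw [tupleCorrection, Finset.sum_range_succ, ← sub_sub]; rfl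
    have h := tupleHomotopy_spec β ((tupleSubdiv k β (p + 1))^[M] (tupleCoboundary k A p φ))
    rw [tupleSubdiv_iterate_tupleCoboundary, tupleCoboundary_tupleCoboundary, map_zero, add_zero,
      ← tupleSubdiv_iterate_tupleCoboundary] at h
    rw [hM, map_sub, ih, h, Function.iterate_succ_apply', sub_sub_cancel]

theorem tupleCorrection_eq_of_le {p : ℕ} {M M' : ℕ} (hM : M ≤ M') (φ : (Fin p → A) → k)
    (h : ∀ N, M ≤ N → (tupleSubdiv k β (p + 1))^[N] (tupleCoboundary k A p φ) = 0) :
    tupleCorrection β M' φ = tupleCorrection β M φ := by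
  induction M', hM using Nat.le_induction with
  | base => rfl
  | succ M' hM ih =>
    rw [← ih, tupleCorrection, Finset.sum_range_succ, h M' hM, map_zero, add_zero]; rfl

theorem tupleCorrection_comp {β} {β' : ∀ p, (Fin (p + 1) → B) → B} {h : A → B}
    (hβ : ∀ p v, h (β p v) = β' p (h ∘ v)) {p : ℕ} (M : ℕ) (φ : (Fin p → B) → k)
    (v : Fin p → A) :
    tupleCorrection β M (fun w => φ (h ∘ w)) v = tupleCorrection β' M φ (h ∘ v) := by
  have hc : tupleCoboundary k A p (fun w => φ (h ∘ w)) =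
      fun w => tupleCoboundary k B p φ (h ∘ w) := rfl
  simp only [tupleCorrection, Pi.sub_apply, Finset.sum_apply, hc, tupleSubdiv_iterate_comp hβ,
    tupleHomotopy_comp hβ]

end TupleCochain

/-! ### Subdivision of the standard simplex -/

section StdSimplexSubdiv

variable {k : Type*} [CommRing k]

/-- The barycenter of a tuple of points of a standard simplex. -/
noncomputable def tupleBarycenter (q p : ℕ) (v : Fin (p + 1) → stdSimplex ℝ (Fin q)) :
    stdSimplex ℝ (Fin q) :=
  ⟨∑ i, ((p : ℝ) + 1)⁻¹ • (v i : Fin q → ℝ), by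
    refine (convex_stdSimplex ℝ (Fin q)).sum_mem (fun _ _ => by positivity) ?_
      (fun i _ => (v i).2)
    rw [Finset.sum_const, Finset.card_univ, Fintype.card_fin, nsmul_eq_mul]
    push_cast
    exact mul_inv_cancel₀ (by positivity)⟩

theorem tupleBarycenter_mem_convexHull {q p : ℕ} (v : Fin (p + 1) → stdSimplex ℝ (Fin q)) :
    (tupleBarycenter q p v : Fin q → ℝ) ∈
      convexHull ℝ (Set.range fun j => (v j : Fin q → ℝ)) := by
  refine (convex_convexHull ℝ (Set.range fun j => (v j : Fin q → ℝ))).sum_mem (t := Finset.univ)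
    (w := fun _ => ((p : ℝ) + 1)⁻¹) (fun _ _ => by positivity) ?_
    (fun i _ => subset_convexHull ℝ _ (Set.mem_range_self i))
  rw [Finset.sum_const, Finset.card_univ, Fintype.card_fin, nsmul_eq_mul]
  push_cast
  exact mul_inv_cancel₀ (by positivity)

theorem map_tupleBarycenter {q r : ℕ} (h : Fin q → Fin r) (p : ℕ)
    (v : Fin (p + 1) → stdSimplex ℝ (Fin q)) :
    stdSimplex.map h (tupleBarycenter q p v) =
      tupleBarycenter r p (stdSimplex.map h ∘ v) := by
  apply Subtype.ext
  change FunOnFinite.linearMap ℝ ℝ h (∑ i, ((p : ℝ) + 1)⁻¹ • (v i : Fin q → ℝ)) =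
    ∑ i, ((p : ℝ) + 1)⁻¹ • FunOnFinite.linearMap ℝ ℝ h (v i : Fin q → ℝ)
  simp only [map_sum, map_smul]

/-- By convexity of balls it suffices to treat a vertex. Among the `p + 1` averaged differences to
that vertex one is zero, whence the factor `p / (p + 1)`. -/
theorem dist_tupleBarycenter_le {q p : ℕ} {v : Fin (p + 1) → stdSimplex ℝ (Fin q)} {D κ : ℝ}
    (hv : ∀ i j, dist (v i) (v j) ≤ D) (hκ : (p : ℝ) / (p + 1) ≤ κ) {x : stdSimplex ℝ (Fin q)}
    (hx : (x : Fin q → ℝ) ∈ convexHull ℝ (Set.range fun j => (v j : Fin q → ℝ))) :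
    dist (tupleBarycenter q p v) x ≤ κ * D := by
  have hD : 0 ≤ D := dist_nonneg.trans (hv 0 0)
  have hp : (0 : ℝ) < p + 1 := by positivity
  rw [dist_comm]
  refine (convexHull_min (t := Metric.closedBall (tupleBarycenter q p v : Fin q → ℝ) (κ * D))
    ?_ (convex_closedBall _ _) hx : _)
  rintro _ ⟨j, rfl⟩
  rw [Metric.mem_closedBall, dist_comm, dist_eq_norm]
  have h1 : (tupleBarycenter q p v : Fin q → ℝ) - (v j : Fin q → ℝ) =
      ((p : ℝ) + 1)⁻¹ • ∑ i, ((v i : Fin q → ℝ) - v j) := by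
    rw [Finset.sum_sub_distrib, Finset.sum_const, Finset.card_univ, Fintype.card_fin, smul_sub,
      Finset.smul_sum, ← Nat.cast_smul_eq_nsmul ℝ, smul_smul]
    push_cast
    rw [inv_mul_cancel₀ hp.ne', one_smul]
    rfl
  have h2 : ‖∑ i, ((v i : Fin q → ℝ) - v j)‖ ≤ p * D := by
    rw [← Finset.add_sum_erase _ _ (Finset.mem_univ j), sub_self, zero_add]
    refine (norm_sum_le_of_le _ (fun i _ => ?_ : ∀ i ∈ Finset.univ.erase j, _ ≤ D)).trans ?_
    · rw [← dist_eq_norm]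
      exact hv i j
    · simp
  rw [h1, norm_smul, Real.norm_of_nonneg (by positivity)]
  calc ((p : ℝ) + 1)⁻¹ * ‖∑ i, ((v i : Fin q → ℝ) - v j)‖ ≤ ((p : ℝ) + 1)⁻¹ * (p * D) := by
        gcongr
    _ = (p : ℝ) / (p + 1) * D := by ring
    _ ≤ κ * D := by gcongr

/-- Only simplices of the subdivision of `v` contribute. Tracking the convex hull through the
induction is what bounds the distance from a new apex to the vertices already built. -/
theorem tupleSubdiv_eq_zero_of_forall_dist_le {q p : ℕ} {κ D : ℝ}
    (hκ : ∀ r < p, (r : ℝ) / (r + 1) ≤ κ)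
    {v : Fin p → stdSimplex ℝ (Fin q)} (hv : ∀ i j, dist (v i) (v j) ≤ D)
    {φ : (Fin p → stdSimplex ℝ (Fin q)) → k}
    (hφ : ∀ w : Fin p → stdSimplex ℝ (Fin q),
      (∀ i, (w i : Fin q → ℝ) ∈ convexHull ℝ (Set.range fun j => (v j : Fin q → ℝ))) →
      (∀ i j, dist (w i) (w j) ≤ κ * D) → φ w = 0) :
    tupleSubdiv k (tupleBarycenter q) p φ v = 0 := by
  induction p with
  | zero => exact hφ v (fun i => i.elim0) (fun i => i.elim0)
  | succ p ih =>
    rw [tupleSubdiv_succ, tupleCoboundary_apply]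
    refine Finset.sum_eq_zero fun i _ => ?_
    rw [ih (v := v ∘ i.succAbove) (fun r hr => hκ r (by omega)) (fun a b => hv _ _), mul_zero]
    intro w hw hww
    have hw' : ∀ j, (w j : Fin q → ℝ) ∈ convexHull ℝ (Set.range fun j => (v j : Fin q → ℝ)) :=
      fun j => convexHull_mono (Set.range_comp_subset_range i.succAbove _) (hw j)
    have hb := fun j => dist_tupleBarycenter_le hv (hκ p (by omega)) (hw' j)
    have hD : 0 ≤ D := dist_nonneg.trans (hv 0 0)
    have hκ0 : 0 ≤ κ := by simpa using hκ 0 (by omega)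
    refine hφ _ (fun j => ?_) (fun a b => ?_)
    · refine Fin.cases ?_ (fun j => ?_) j
      · exact tupleBarycenter_mem_convexHull v
      · exact hw' j
    · refine Fin.cases ?_ (fun a => ?_) a <;> refine Fin.cases ?_ (fun b => ?_) b
      · simp only [Fin.cons_zero, dist_self]
        positivity
      · simpa using hb b
      · simpa [dist_comm] using hb a
      · simpa using hww a b

theorem tupleSubdiv_iterate_apply_eq_zero {q p : ℕ} {r : ℝ}
    {φ : (Fin p → stdSimplex ℝ (Fin q)) → k}
    (hφ : ∀ w, (∀ i j, dist (w i) (w j) ≤ r) → φ w = 0) (N : ℕ) {D : ℝ}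
    (hD : ((p : ℝ) / (p + 1)) ^ N * D ≤ r) {v : Fin p → stdSimplex ℝ (Fin q)}
    (hv : ∀ i j, dist (v i) (v j) ≤ D) :
    (tupleSubdiv k (tupleBarycenter q) p)^[N] φ v = 0 := by
  induction N generalizing v D with
  | zero => exact hφ v (fun i j => (hv i j).trans (by simpa using hD))
  | succ N ih =>
    rw [Function.iterate_succ_apply']
    -- A tuple of `p` points would allow the ratio `(p - 1) / p`; the cruder one also covers `p =
    -- 0`.
    refine tupleSubdiv_eq_zero_of_forall_dist_le (κ := (p : ℝ) / (p + 1)) (fun s hs => ?_) hv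
      (fun w _ hw => ih (by rwa [← mul_assoc, ← pow_succ]) hw)
    have : (s : ℝ) ≤ p := by exact_mod_cast hs.le
    rw [div_le_div_iff₀ (by positivity) (by positivity)]
    linarith

theorem stdSimplex_dist_le_one {q : ℕ} (x y : stdSimplex ℝ (Fin q)) : dist x y ≤ 1 := by
  refine (dist_pi_le_iff zero_le_one).2 fun a => ?_
  rw [Real.dist_eq, abs_le]
  have h1 := stdSimplex.zero_le x a
  have h2 := stdSimplex.zero_le y a
  have h3 := stdSimplex.le_one x a
  have h4 := stdSimplex.le_one y a
  change -1 ≤ x a - y a ∧ x a - y a ≤ 1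
  constructor <;> linarith

theorem exists_tupleSubdiv_iterate_eq_zero {q p : ℕ} {r : ℝ} (hr : 0 < r)
    {φ : (Fin p → stdSimplex ℝ (Fin q)) → k}
    (hφ : ∀ w, (∀ i j, dist (w i) (w j) ≤ r) → φ w = 0) :
    ∃ M, ∀ N, M ≤ N → (tupleSubdiv k (tupleBarycenter q) p)^[N] φ = 0 := by
  have hlt : (p : ℝ) / (p + 1) < 1 := by
    rw [div_lt_one (by positivity)]
    linarith
  obtain ⟨M, hM⟩ := exists_pow_lt_of_lt_one hr hlt
  refine ⟨M, fun N hN => funext fun v =>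
    tupleSubdiv_iterate_apply_eq_zero hφ N (D := 1) ?_ (fun i j => stdSimplex_dist_le_one _ _)⟩
  rw [mul_one]
  exact (pow_le_pow_of_le_one (by positivity) hlt.le hN).trans hM.le

end StdSimplexSubdiv

/-! ### Labellings of a simplex -/

section Labelling

variable {k : Type*} [CommRing k]

/-- The determinant of a labelling of the vertices of a simplex, as a map of vertices: the
signature of a bijective labelling, and zero otherwise. -/
def labelDet (k : Type*) [CommRing k] {p : ℕ} (l : Fin p → Fin p) : k :=
  (Matrix.of fun a b => if l a = b then (1 : k) else 0).det

/-- The signed indicator of the labellings which are bijective onto the nonzero labels. -/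
def faceDet (k : Type*) [CommRing k] {p : ℕ} (l : Fin p → Fin (p + 1)) : k :=
  (Matrix.of fun a b => if l a = Fin.succ b then (1 : k) else 0).det

/-- Each row of the label matrix has a single 1, so adding all other columns to column `0` makes
that column constantly 1. Laplace expansion along it produces the alternating sum of the minors
`faceDet`. -/
theorem tupleCoboundary_faceDet {p : ℕ} (l : Fin (p + 1) → Fin (p + 1)) :
    tupleCoboundary k (Fin (p + 1)) p (faceDet k) l = labelDet k l := by
  set B : Matrix (Fin (p + 1)) (Fin (p + 1)) k :=
    Matrix.of fun a b => if l a = b then (1 : k) else 0 with hB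
  have h := Matrix.det_updateCol_sum B 0 1
  rw [Pi.one_apply, one_smul] at h
  change _ = B.det
  rw [← h, Matrix.det_succ_column_zero, tupleCoboundary_apply]
  refine Finset.sum_congr rfl fun i _ => ?_
  have h1 : ∑ j, B i j = 1 := by simp [hB]
  simp only [Matrix.updateCol_self, Pi.one_apply, one_smul, h1, mul_one]
  congr 1

theorem labelDet_eq_zero {p : ℕ} {l : Fin p → Fin p} {b : Fin p} (hb : ∀ a, l a ≠ b) :
    labelDet k l = 0 :=
  Matrix.det_eq_zero_of_column_eq_zero b fun a => by simp [hb a]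

theorem faceDet_eq_zero {p : ℕ} {l : Fin p → Fin (p + 1)} {b : Fin p}
    (hb : ∀ a, l a ≠ b.succ) : faceDet k l = 0 :=
  Matrix.det_eq_zero_of_column_eq_zero b fun a => by simp [hb a]

theorem stdSimplex_map_succAbove_self {p : ℕ} (i : Fin (p + 1)) (x : stdSimplex ℝ (Fin p)) :
    stdSimplex.map i.succAbove x i = 0 := by
  rw [stdSimplex.map_coe, FunOnFinite.linearMap_apply_apply]
  exact Finset.sum_eq_zero fun j hj => absurd (Finset.mem_filter.1 hj).2 (Fin.succAbove_ne i j)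

theorem stdSimplex_map_succAbove {p : ℕ} (i : Fin (p + 1)) (x : stdSimplex ℝ (Fin p))
    (j : Fin p) : stdSimplex.map i.succAbove x (i.succAbove j) = x j := by
  rw [stdSimplex.map_coe, FunOnFinite.linearMap_apply_apply, Finset.sum_eq_single j]
  · intro b hb hbj
    exact absurd (Fin.succAbove_right_injective (Finset.mem_filter.1 hb).2) hbj
  · simp

/-- The tuple of vertices of a standard simplex. -/
noncomputable def vertexTuple (q : ℕ) : Fin q → stdSimplex ℝ (Fin q) :=
  fun i => stdSimplex.vertex i

theorem map_comp_vertexTuple {q r : ℕ} (h : Fin q → Fin r) :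
    stdSimplex.map h ∘ vertexTuple q = vertexTuple r ∘ h := by
  funext i
  exact stdSimplex.map_vertex h i

/-- An oriented version of Sperner's lemma for iterated barycentric subdivisions. -/
theorem tupleSubdiv_iterate_labelDet (M : ℕ) {p : ℕ} {f : stdSimplex ℝ (Fin p) → Fin p}
    (hf : ∀ x : stdSimplex ℝ (Fin p), x (f x) ≠ 0) :
    (tupleSubdiv k (tupleBarycenter p) p)^[M] (fun v => labelDet k (f ∘ v)) (vertexTuple p) =
      1 := by
  induction p with
  | zero =>
    have : ∀ φ : (Fin 0 → stdSimplex ℝ (Fin 0)) → k,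
        (tupleSubdiv k (tupleBarycenter 0) 0)^[M] φ = φ := fun φ => Function.iterate_fixed rfl M
    rw [this]
    exact Matrix.det_isEmpty
  | succ p ih =>
    have hG : (fun v : Fin (p + 1) → stdSimplex ℝ (Fin (p + 1)) => labelDet k (f ∘ v)) =
        tupleCoboundary k _ p (fun w => faceDet k (f ∘ w)) := by
      funext v
      rw [tupleCoboundary_comp, tupleCoboundary_faceDet]
    -- The count becomes a sum over facets. Only the facet opposite vertex `0` survives: there label
    -- `0` is absent and the remaining labels form a Sperner labelling one dimension lower.
    rw [hG, tupleSubdiv_iterate_tupleCoboundary, tupleCoboundary_apply, Fin.sum_univ_succ,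
      Finset.sum_eq_zero, add_zero]
    · have hne : ∀ x : stdSimplex ℝ (Fin p), f (stdSimplex.map (Fin.succAbove 0) x) ≠ 0 := by
        intro x h
        have := hf (stdSimplex.map (Fin.succAbove 0) x)
        rw [h, stdSimplex_map_succAbove_self] at this
        exact this rfl
      rw [← map_comp_vertexTuple]
      have hc := congr_fun (tupleSubdiv_iterate_comp (k := k) (β := tupleBarycenter p)
        (map_tupleBarycenter (Fin.succAbove (0 : Fin (p + 1))))
        (fun w : Fin p → _ => faceDet k (f ∘ w)) M) (vertexTuple p)
      rw [← hc, Fin.val_zero, pow_zero, one_mul]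
      rw [← ih (f := fun x => (f (stdSimplex.map (Fin.succAbove 0) x)).pred (hne x))]
      · refine congr_fun (congr_arg _ (funext fun v => ?_)) _
        simp only [faceDet, labelDet]
        congr 1
        funext a b
        simp [Fin.pred_eq_iff_eq_succ]
        rfl
      · intro x h
        have h1 := stdSimplex_map_succAbove 0 x
          ((f (stdSimplex.map (Fin.succAbove 0) x)).pred (hne x))
        have h2 : Fin.succAbove 0 ((f (stdSimplex.map (Fin.succAbove 0) x)).pred (hne x)) =
            f (stdSimplex.map (Fin.succAbove 0) x) := by simp
        rw [h2] at h1
        exact hf _ (h1.trans h)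
    -- Label `i.succ` cannot occur on the facet where that coordinate vanishes, so `faceDet` is zero
    -- there.
    · intro i _
      rw [← map_comp_vertexTuple]
      have hc := congr_fun (tupleSubdiv_iterate_comp (k := k) (β := tupleBarycenter p)
        (map_tupleBarycenter (Fin.succAbove i.succ))
        (fun w : Fin p → _ => faceDet k (f ∘ w)) M) (vertexTuple p)
      rw [← hc]
      have h0 : (fun w : Fin p → stdSimplex ℝ (Fin p) =>
          faceDet k (f ∘ (stdSimplex.map (Fin.succAbove i.succ) ∘ w))) = 0 := by
        funext w
        refine faceDet_eq_zero (b := i) fun a h => ?_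
        have := hf (stdSimplex.map (Fin.succAbove i.succ) (w a))
        rw [Function.comp_apply, Function.comp_apply] at h
        rw [h, stdSimplex_map_succAbove_self] at this
        exact this rfl
      rw [h0, Function.iterate_fixed (map_zero _)]
      simp

end Labelling

/-! ### The cocycle of a labelling -/

section LabelCocycle

variable {k : Type*} [CommRing k]

/-- Fine subdivisions of the simplex contain no simplex on which the labelling `f` takes all
values. -/
def IsFineLabelling (k : Type*) [CommRing k] {q p : ℕ} (f : stdSimplex ℝ (Fin q) → Fin p)
    (M : ℕ) : Prop :=
  ∀ N, M ≤ N → (tupleSubdiv k (tupleBarycenter q) p)^[N] (fun v => labelDet k (f ∘ v)) = 0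

theorem IsFineLabelling.mono {q p : ℕ} {f : stdSimplex ℝ (Fin q) → Fin p} {M M' : ℕ}
    (h : IsFineLabelling k f M) (hM : M ≤ M') : IsFineLabelling k f M' :=
  fun N hN => h N (hM.trans hN)

theorem IsFineLabelling.comp_map {q r p : ℕ} {f : stdSimplex ℝ (Fin r) → Fin p} {M : ℕ}
    (h : IsFineLabelling k f M) (a : Fin q → Fin r) :
    IsFineLabelling k (f ∘ stdSimplex.map a) M := by
  intro N hN
  have := tupleSubdiv_iterate_comp (k := k) (map_tupleBarycenter a)
    (fun v : Fin p → _ => labelDet k (f ∘ v)) N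
  rw [h N hN] at this
  exact this

theorem tupleCoboundary_faceDet_comp {A : Type*} {p : ℕ} (f : A → Fin (p + 1)) :
    tupleCoboundary k A p (fun w => faceDet k (f ∘ w)) = fun v => labelDet k (f ∘ v) := by
  funext v
  rw [tupleCoboundary_comp, tupleCoboundary_faceDet]

open Classical in
/-- The value of the cocycle attached to labellings on a labelled simplex. -/
noncomputable def labelValue (k : Type*) [CommRing k] {p : ℕ}
    (f : stdSimplex ℝ (Fin p) → Fin (p + 1)) : k :=
  if h : ∃ M, IsFineLabelling k f M then
    tupleCorrection (tupleBarycenter p) h.choose (fun w => faceDet k (f ∘ w)) (vertexTuple p)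
  else 0

/-- The corrections stabilise once the subdivision is fine, so the chosen level is irrelevant; by
naturality the value on a face can be computed inside the ambient simplex. -/
theorem labelValue_comp_map {q p M : ℕ} {f : stdSimplex ℝ (Fin q) → Fin (p + 1)}
    (a : Fin p → Fin q) (hM : IsFineLabelling k (f ∘ stdSimplex.map a) M) :
    labelValue k (f ∘ stdSimplex.map a) =
      tupleCorrection (tupleBarycenter q) M (fun w => faceDet k (f ∘ w))
        (vertexTuple q ∘ a) := by
  have h : ∃ M, IsFineLabelling k (f ∘ stdSimplex.map a) M := ⟨M, hM⟩
  rw [labelValue, dif_pos h, ← map_comp_vertexTuple, ← tupleCorrection_comp (map_tupleBarycenter a)]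
  have key : ∀ {N}, IsFineLabelling k (f ∘ stdSimplex.map a) N →
      ∀ N', N ≤ N' → (tupleSubdiv k (tupleBarycenter p) (p + 1))^[N']
        (tupleCoboundary k _ p (fun w => faceDet k ((f ∘ stdSimplex.map a) ∘ w))) = 0 := by
    intro N hN N' hNN'
    rw [tupleCoboundary_faceDet_comp]
    exact hN N' hNN'
  have h1 := tupleCorrection_eq_of_le (tupleBarycenter p) (le_max_left h.choose M) _
    (key h.choose_spec)
  have h2 := tupleCorrection_eq_of_le (tupleBarycenter p) (le_max_right h.choose M) _ (key hM)
  rw [← h1, h2]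
  rfl

/-- Fineness is assumed on the facets only. If it also holds on the whole simplex the right side is
0, giving the cocycle condition; for a Sperner labelling it is 1. -/
theorem sum_labelValue_eq {p M : ℕ} {f : stdSimplex ℝ (Fin (p + 1)) → Fin (p + 1)}
    (hM : ∀ i : Fin (p + 1), IsFineLabelling k (f ∘ stdSimplex.map i.succAbove) M) :
    ∑ i : Fin (p + 1), (-1 : k) ^ (i : ℕ) * labelValue k (f ∘ stdSimplex.map i.succAbove) =
      (tupleSubdiv k (tupleBarycenter (p + 1)) (p + 1))^[M] (fun v => labelDet k (f ∘ v))
        (vertexTuple (p + 1)) := by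
  simp only [fun i => labelValue_comp_map _ (hM i)]
  rw [← tupleCoboundary_apply, tupleCoboundary_tupleCorrection, tupleCoboundary_faceDet_comp]

/-- The complements of the `K i` pull back to an open cover of the simplex. A tuple smaller than a
Lebesgue number avoids some `K i`, hence misses label `i`. -/
theorem exists_isFineLabelling {X : Type*} [TopologicalSpace X] {p q : ℕ} {l : X → Fin (p + 1)}
    {K : Fin (p + 1) → Set X} (hK : ∀ i, IsClosed (K i)) (hl : ∀ x, x ∈ K (l x))
    (hK0 : ∀ x, ∃ i, x ∉ K i) (σ : C(stdSimplex ℝ (Fin q), X)) :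
    ∃ M, IsFineLabelling k (l ∘ σ) M := by
  obtain ⟨δ, hδ, hball⟩ := lebesgue_number_lemma_of_metric
    (c := fun i => σ ⁻¹' (K i)ᶜ) (isCompact_univ (X := stdSimplex ℝ (Fin q)))
    (fun i => (hK i).isOpen_compl.preimage σ.continuous)
    (fun x _ => Set.mem_iUnion.2 (hK0 (σ x)))
  refine exists_tupleSubdiv_iterate_eq_zero (half_pos hδ) fun w hw => ?_
  obtain ⟨i, hi⟩ := hball (w 0) (Set.mem_univ _)
  refine labelDet_eq_zero (b := i) fun a ha => ?_
  have h1 : w a ∈ σ ⁻¹' (K i)ᶜ := hi (by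
    rw [Metric.mem_ball]
    exact (hw a 0).trans_lt (half_lt_self hδ))
  apply h1
  rw [← ha]
  exact hl _

theorem singularCoboundary_apply {X : Type*} [TopologicalSpace X] {q : ℕ}
    (φ : SingularCochain k X q) (σ : SingularSimplex X (q + 1)) :
    singularCoboundary k X q φ σ = ∑ i : Fin (q + 1), (-1 : k) ^ (i : ℕ) * φ (σ.face i) := rfl

/-- The boundary of the standard simplex. -/
def simplexBoundary (q : ℕ) : Set (stdSimplex ℝ (Fin q)) := {x | ∃ i, x i = 0}

/-- Extension by zero to simplices leaving the boundary. It allows the double coboundary to be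
evaluated on the identity simplex, which does not itself map into `X`. -/
theorem exists_extension_singularCochain {X : Type*} [TopologicalSpace X] {p q : ℕ}
    (α : C(simplexBoundary p, X)) (ψ : SingularCochain k X q) :
    ∃ ψ' : SingularCochain k (stdSimplex ℝ (Fin p)) q,
      ∀ σ : SingularSimplex (simplexBoundary p) q,
        ψ' (ContinuousMap.comp ⟨Subtype.val, continuous_subtype_val⟩ σ) = ψ (α.comp σ) := by
  classical
  refine ⟨fun τ => if h : ∀ x, τ x ∈ simplexBoundary p then
    ψ (α.comp ⟨fun x => ⟨τ x, h x⟩, by fun_prop⟩) else 0, fun σ => ?_⟩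
  exact dif_pos fun x => (σ x).2

/-- The label cocycle is paired with the boundary sphere `α`. The pairing is 1 by Sperner's lemma,
but a primitive `ψ` would make it a double coboundary, hence 0. -/
theorem not_subsingleton_reducedCohomology [Nontrivial k] {X : Type*} [TopologicalSpace X]
    {m : ℕ} {l : X → Fin (m + 2)} {K : Fin (m + 2) → Set X} (hK : ∀ i, IsClosed (K i))
    (hl : ∀ x, x ∈ K (l x)) (hK0 : ∀ x, ∃ i, x ∉ K i) (α : C(simplexBoundary (m + 2), X))
    (hα : ∀ x : simplexBoundary (m + 2), x.1 (l (α x)) ≠ 0) :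
    ¬ Subsingleton (ReducedCohomology k X (m + 1)) := by
  intro hsub
  have hfine := fun {q : ℕ} (σ : SingularSimplex X q) =>
    exists_isFineLabelling (k := k) hK hl hK0 σ
  let c : SingularCochain k X (m + 1) := fun σ => labelValue k (l ∘ σ)
  have hc : singularCoboundary k X (m + 1) c = 0 := by
    funext σ
    obtain ⟨M, hM⟩ := hfine σ
    have := sum_labelValue_eq fun i => hM.comp_map (Fin.succAbove i)
    rw [hM M le_rfl] at this
    exact this
  have hcob : c ∈ LinearMap.range (singularCoboundary k X m) := by
    have h1 : (reducedCoboundaries k X (m + 1)).submoduleOf (reducedCocycles k X (m + 1)) = ⊤ :=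
      Submodule.Quotient.subsingleton_iff.1 hsub
    have h2 : (⟨c, hc⟩ : reducedCocycles k X (m + 1)) ∈
        (reducedCoboundaries k X (m + 1)).submoduleOf (reducedCocycles k X (m + 1)) := by
      rw [h1]
      trivial
    exact h2
  obtain ⟨ψ, hψ⟩ := hcob
  obtain ⟨ψ', hψ'⟩ := exists_extension_singularCochain α ψ
  let τ : Fin (m + 2) → SingularSimplex (simplexBoundary (m + 2)) (m + 1) := fun i =>
    ⟨fun x => ⟨stdSimplex.map i.succAbove x, i, stdSimplex_map_succAbove_self i x⟩,
      (stdSimplex.continuous_map _).subtype_mk _⟩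
  classical
  let f : stdSimplex ℝ (Fin (m + 2)) → Fin (m + 2) := fun x =>
    -- The interior label `0` is arbitrary: all coordinates are nonzero there, so the Sperner
    -- condition is automatic.
    if h : x ∈ simplexBoundary (m + 2) then l (α ⟨x, h⟩) else 0
  have hf : ∀ x : stdSimplex ℝ (Fin (m + 2)), x (f x) ≠ 0 := by
    intro x
    by_cases h : x ∈ simplexBoundary (m + 2)
    · simp only [f, dif_pos h]
      exact hα ⟨x, h⟩
    · exact fun h0 => h ⟨_, h0⟩
  have hfτ : ∀ i : Fin (m + 2), f ∘ stdSimplex.map i.succAbove = l ∘ (α.comp (τ i)) := by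
    intro i
    funext x
    have h : stdSimplex.map i.succAbove x ∈ simplexBoundary (m + 2) :=
      ⟨i, stdSimplex_map_succAbove_self i x⟩
    exact dif_pos h
  choose M hM using fun i => hfine (α.comp (τ i))
  have h1 := sum_labelValue_eq (k := k) (f := f) (M := Finset.univ.sup M) fun i => by
    rw [hfτ]
    exact (hM i).mono (Finset.le_sup (Finset.mem_univ i))
  rw [tupleSubdiv_iterate_labelDet _ hf] at h1
  have h2 := congr_fun (LinearMap.congr_fun (singularCoboundary_comp k
    (stdSimplex ℝ (Fin (m + 2))) m) ψ') (ContinuousMap.id _)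
  rw [LinearMap.comp_apply, singularCoboundary_apply, LinearMap.zero_apply, Pi.zero_apply] at h2
  refine zero_ne_one (α := k) ?_
  rw [← h1, ← h2]
  refine Finset.sum_congr rfl fun i _ => ?_
  rw [hfτ]
  congr 1
  change _ = c (α.comp (τ i))
  rw [← hψ, singularCoboundary_apply, singularCoboundary_apply]
  refine Finset.sum_congr rfl fun j _ => ?_
  congr 1
  exact hψ' ((τ i).face j)

end LabelCocycle

/-! ### The boundary of a chamber -/

section Chamber

variable {k : Type*} [CommRing k] {n : ℕ}

theorem flip_one_inter (g : Fin n → ℤˣ) : SignPattern.flip 1 (SignPattern.inter 1 g) = g := by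
  funext i
  rcases Int.units_eq_one_or (g i) with h | h <;> simp [SignPattern.flip, SignPattern.inter, h]

theorem mem_farkasSpace {L : Submodule ℝ (EuclideanSpace ℝ (Fin n))} {g : Fin n → ℤˣ}
    {x : EuclideanSpace ℝ (Fin n)} :
    x ∈ farkasSpace L g ↔
      x ∈ L ∧ ‖x‖ = 1 ∧ (∀ i, 0 ≤ ((g i : ℤ) : ℝ) * x i) ∧ ∃ i, g i = 1 ∧ x i = 0 := by
  have h : ∀ i, SignPattern.inter 1 g i ≠ none ↔ g i = 1 := by
    intro i
    simp [SignPattern.inter, eq_comm]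
  simp only [farkasSpace, Set.mem_inter_iff, mem_starBoundary, flip_one_inter,
    mem_closedCell_toPartial, h, SetLike.mem_coe]
  tauto

theorem exists_equiv_map_eq_one {V : Type*} [NormedAddCommGroup V] [NormedSpace ℝ V] {m : ℕ}
    (hV : Module.finrank ℝ V = m + 1) {u : V} (hu : u ≠ 0) :
    ∃ E : V ≃L[ℝ] (Fin (m + 1) → ℝ), E u = 1 := by
  have : FiniteDimensional ℝ V := .of_finrank_eq_succ hV
  let e : V ≃L[ℝ] (Fin (m + 1) → ℝ) := ContinuousLinearEquiv.ofFinrankEq (by simp [hV])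
  obtain ⟨A, hA⟩ := SeparatingDual.exists_continuousLinearEquiv_apply_eq (R := ℝ)
    (x := e u) (y := 1) (by simpa using hu) one_ne_zero
  exact ⟨e.trans A, by simpa using hA⟩

/-- If every point of the boundary of the chamber containing `u` has a vanishing coordinate of
positive sign, then the Farkas space of the chamber has nonzero cohomology. -/
theorem exists_not_subsingleton_reducedCohomology [Nontrivial k]
    (L : Submodule ℝ (EuclideanSpace ℝ (Fin n))) (hdim : 2 ≤ Module.finrank ℝ L)
    (g : Fin n → ℤˣ) (u : L) (hu : ∀ i, 0 < ((g i : ℤ) : ℝ) * u.1 i)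
    (hg : ∀ x ∈ L, (∀ i, 0 ≤ ((g i : ℤ) : ℝ) * x i) → (∃ i, x i = 0) → ∃ i, g i = 1 ∧ x i = 0) :
    ∃ q, ¬ Subsingleton (ReducedCohomology k (farkasSpace L g) q) := by
  obtain ⟨m, hm⟩ := Nat.exists_eq_add_of_le' hdim
  have : Nonempty (Fin n) := by
    by_contra h
    rw [not_nonempty_iff] at h
    have : Module.finrank ℝ L = 0 := Module.finrank_zero_of_subsingleton
    omega
  have hui : ∀ i, u.1 i ≠ 0 := fun i h => by simpa [h] using hu i
  have hu0 : u ≠ 0 := by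
    rintro rfl
    exact hui (Classical.arbitrary _) rfl
  obtain ⟨E, hE⟩ := exists_equiv_map_eq_one (m := m + 1) hm hu0
  let toL : farkasSpace L g → L := fun x => ⟨x.1, (mem_farkasSpace.1 x.2).1⟩
  have htoL : Continuous toL := by fun_prop
  choose l hl using fun w : Fin (m + 2) → ℝ => Finite.exists_max w
  -- The least multiple of `u` that moves the vector into the closed chamber; `y w` is the boundary
  -- point reached.
  let t : (Fin (m + 2) → ℝ) → ℝ := fun w =>
    Finset.univ.sup' Finset.univ_nonempty fun i => -((E.symm w).1 i) / u.1 i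
  have ht : Continuous t := by
    refine Continuous.finset_sup'_apply _ fun i _ => ?_
    fun_prop
  let y : (Fin (m + 2) → ℝ) → L := fun w => E.symm w + t w • u
  have hy : Continuous y := by fun_prop
  have hEy : ∀ w, E (y w) = w + t w • 1 := fun w => by simp [y, hE]
  have hcoord : ∀ w i, ((g i : ℤ) : ℝ) * (y w).1 i =
      (((g i : ℤ) : ℝ) * u.1 i) * (t w - -((E.symm w).1 i) / u.1 i) := by
    intro w i
    have h1 : (y w).1 i = (E.symm w).1 i + t w * u.1 i := rfl
    rw [h1]
    field_simp [hui i]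
    ring
  have hy1 : ∀ w i, 0 ≤ ((g i : ℤ) : ℝ) * (y w).1 i := by
    intro w i
    rw [hcoord]
    refine mul_nonneg (hu i).le (sub_nonneg.2 ?_)
    exact Finset.le_sup' (fun i => -((E.symm w).1 i) / u.1 i) (Finset.mem_univ i)
  have hy2 : ∀ w, ∃ i, (y w).1 i = 0 := by
    intro w
    obtain ⟨i, -, hi⟩ := Finset.exists_mem_eq_sup' Finset.univ_nonempty
      fun i => -((E.symm w).1 i) / u.1 i
    refine ⟨i, ?_⟩
    have h1 := hcoord w i
    have h2 : t w = -((E.symm w).1 i) / u.1 i := hi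
    rw [h2, sub_self, mul_zero] at h1
    exact (mul_eq_zero.1 h1).resolve_left (by simp)
  have hy0 : ∀ x : simplexBoundary (m + 2), y x.1.1 ≠ 0 := by
    rintro ⟨x, i, hi⟩ h
    have h1 := hEy x.1
    rw [h, map_zero] at h1
    have h2 : ∀ j, x j = -t x.1 := fun j => by
      have := congr_fun h1 j
      simp only [Pi.zero_apply, Pi.add_apply, Pi.smul_apply, Pi.one_apply, smul_eq_mul,
        mul_one] at this
      exact eq_neg_of_add_eq_zero_left this.symm
    have h3 : ∀ j, x j = 0 := fun j => by rw [h2, ← h2 i, hi]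
    have h4 := stdSimplex.sum_eq_one x
    simp [h3] at h4
  let α : C(simplexBoundary (m + 2), farkasSpace L g) :=
    ⟨fun x => ⟨‖(y x.1.1).1‖⁻¹ • (y x.1.1).1, by
      have hne : (y x.1.1).1 ≠ 0 := fun h => hy0 x (Subtype.ext h)
      have hpos : 0 < ‖(y x.1.1).1‖⁻¹ := inv_pos.2 (norm_pos_iff.2 hne)
      obtain ⟨i, hi, hi0⟩ := hg _ (y x.1.1).2 (hy1 _) (hy2 _)
      refine mem_farkasSpace.2 ⟨L.smul_mem _ (y x.1.1).2, ?_, fun i => ?_, i, hi, ?_⟩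
      · rw [norm_smul, norm_inv, norm_norm, inv_mul_cancel₀ (norm_ne_zero_iff.2 hne)]
      · rw [PiLp.smul_apply, smul_eq_mul, mul_left_comm]
        exact mul_nonneg hpos.le (hy1 _ i)
      · rw [PiLp.smul_apply, hi0, smul_zero]⟩, by
      have h1 : Continuous fun x : simplexBoundary (m + 2) => (y x.1.1).1 := by fun_prop
      exact ((h1.norm.inv₀ fun x => norm_ne_zero_iff.2
        fun h => hy0 x (Subtype.ext h)).smul h1).subtype_mk _⟩
  -- Since `E u = 1`, adding a multiple of `u` shifts all coordinates equally and preserves which is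
  -- largest. If all coordinates were largest at once, the point would be a multiple of `u`; having
  -- a zero coordinate, it would vanish.
  refine ⟨m + 1, not_subsingleton_reducedCohomology (l := fun x => l (E (toL x)))
    (K := fun i => {x | ∀ j, E (toL x) j ≤ E (toL x) i}) (fun i => ?_) (fun x => hl _)
    (fun x => ?_) α (fun x hx => ?_)⟩
  · simp only [Set.ofPred_forall]
    refine isClosed_iInter fun j => isClosed_le ?_ ?_ <;> fun_prop
  · by_contra! h
    obtain ⟨hxL, hx1, hx2, i, -, hi⟩ := mem_farkasSpace.1 x.2
    have hconst : E (toL x) = E (E (toL x) 0 • u) := by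
      rw [map_smul, hE]
      funext j
      simpa using le_antisymm (h 0 j) (h j 0)
    have h1 : x.1 = E (toL x) 0 • u.1 := congr_arg Subtype.val (E.injective hconst)
    have h2 : E (toL x) 0 = 0 := by
      rw [h1, PiLp.smul_apply, smul_eq_mul] at hi
      exact (mul_eq_zero.1 hi).resolve_right (hui i)
    rw [h2, zero_smul] at h1
    simp [h1] at hx1
  · have hpos : 0 < ‖(y x.1.1).1‖⁻¹ :=
      inv_pos.2 (norm_pos_iff.2 fun h => hy0 x (Subtype.ext h))
    have h1 : E (toL (α x)) = ‖(y x.1.1).1‖⁻¹ • (x.1.1 + t x.1.1 • 1) := by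
      rw [← hEy, ← map_smul]
      rfl
    have h2 : ∀ j, x.1 j ≤ 0 := by
      intro j
      have h3 := hl (E (toL (α x))) j
      rw [h1] at h3
      simp only [Pi.smul_apply, Pi.add_apply, smul_eq_mul, Pi.one_apply, mul_one] at h3
      have h4 := le_of_mul_le_mul_left h3 hpos
      rw [← h1] at h4
      have h5 : x.1.1 (l (E (toL (α x)))) = 0 := hx
      rw [h5] at h4
      change x.1.1 j ≤ 0
      linarith
    have h3 := stdSimplex.sum_eq_one x.1
    have h4 := Finset.sum_nonpos fun j (_ : j ∈ Finset.univ) => h2 j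
    linarith

/-- A linear subspace not contained in a coordinate hyperplane meets a chamber. -/
theorem exists_forall_ne_zero {L : Submodule ℝ (EuclideanSpace ℝ (Fin n))}
    (hcoord : ∀ i : Fin n, ∃ x ∈ L, x i ≠ 0) : ∃ x ∈ L, ∀ i, x i ≠ 0 := by
  classical
  suffices h : ∀ s : Finset (Fin n), ∃ x ∈ L, ∀ i ∈ s, x i ≠ 0 by
    obtain ⟨x, hx, h⟩ := h Finset.univ
    exact ⟨x, hx, fun i => h i (Finset.mem_univ i)⟩
  intro s
  induction s using Finset.induction_on with
  | empty => exact ⟨0, L.zero_mem, by simp⟩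
  | insert a s _ ih =>
    obtain ⟨x, hx, hxs⟩ := ih
    obtain ⟨z, hz, hza⟩ := hcoord a
    -- Each coordinate of `z + c • x` excludes at most one value of `c`.
    have hfin : (⋃ i ∈ insert a s, {c : ℝ | z i + c * x i = 0 ∧ (z i ≠ 0 ∨ x i ≠ 0)}).Finite := by
      refine Set.Finite.biUnion (Finset.finite_toSet _) fun i _ => ?_
      refine Set.Subsingleton.finite fun c hc d hd => ?_
      obtain ⟨hc, hcx⟩ := hc
      obtain ⟨hd, -⟩ := hd
      by_cases hxi : x i = 0
      · simp [hxi] at hc hcx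
        exact absurd hc hcx
      · exact mul_right_cancel₀ hxi (by linarith)
    obtain ⟨c, hc⟩ := hfin.infinite_compl.nonempty
    refine ⟨z + c • x, L.add_mem hz (L.smul_mem c hx), fun i hi h => hc ?_⟩
    refine Set.mem_biUnion hi ⟨by simpa using h, ?_⟩
    rcases Finset.mem_insert.1 hi with rfl | hi
    · exact Or.inl hza
    · exact Or.inr (hxs i hi)

/-- A chamber with as many positive signs as possible, if it is not the positive one. -/
theorem exists_chamber {L : Submodule ℝ (EuclideanSpace ℝ (Fin n))}
    (hcoord : ∀ i : Fin n, ∃ x ∈ L, x i ≠ 0) :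
    ∃ (g : Fin n → ℤˣ) (u : L), (∀ i, 0 < ((g i : ℤ) : ℝ) * u.1 i) ∧
      ∀ x ∈ L, (∀ i, 0 ≤ ((g i : ℤ) : ℝ) * x i) → (∃ i, x i = 0) → ∃ i, g i = 1 ∧ x i = 0 := by
  classical
  let S : Finset (Fin n → ℤˣ) :=
    {g | ∃ u : L, ∀ i, 0 < ((g i : ℤ) : ℝ) * u.1 i}
  have hS : S.Nonempty := by
    obtain ⟨x, hx, hx0⟩ := exists_forall_ne_zero hcoord
    refine ⟨fun i => if 0 < x i then 1 else -1, Finset.mem_filter.2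
      ⟨Finset.mem_univ _, ⟨x, hx⟩, fun i => ?_⟩⟩
    by_cases h : 0 < x i
    · simp [h]
    · simpa [h] using lt_of_le_of_ne (not_lt.1 h) (hx0 i)
  obtain ⟨g, hgS, hgmax⟩ := S.exists_max_image
    (fun g => (Finset.univ.filter fun i => g i = 1).card) hS
  obtain ⟨u, hu⟩ := (Finset.mem_filter.1 hgS).2
  refine ⟨g, u, hu, fun x hx hxg ⟨i₀, hi₀⟩ => ?_⟩
  by_contra! hcon
  -- For small `ε`, `x - ε • u` keeps the signs of `g` where `x` is nonzero and is positive where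
  -- `x` vanishes, as `u` is negative there. This contradicts maximality.
  have hev : ∀ i, ∀ᶠ ε in nhdsWithin (0 : ℝ) (Set.Ioi 0),
      x i ≠ 0 → 0 < ((g i : ℤ) : ℝ) * (x i - ε * u.1 i) := by
    intro i
    by_cases hxi : x i = 0
    · simp [hxi]
    · have hpos : 0 < ((g i : ℤ) : ℝ) * (x i - 0 * u.1 i) := by
        rw [zero_mul, sub_zero]
        exact lt_of_le_of_ne (hxg i) (Ne.symm (mul_ne_zero (by simp) hxi))
      have hc : Continuous fun ε : ℝ => ((g i : ℤ) : ℝ) * (x i - ε * u.1 i) := by fun_prop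
      exact (((hc.tendsto 0).eventually_const_lt hpos).filter_mono nhdsWithin_le_nhds).mono
        fun _ h _ => h
  obtain ⟨ε, hε, hε0⟩ := ((Filter.eventually_all.2 hev).and self_mem_nhdsWithin).exists
  replace hε0 : 0 < ε := hε0
  have hneg : ∀ i, x i = 0 → g i = -1 := fun i hi =>
    (Int.units_eq_one_or (g i)).resolve_left fun h => hcon i h hi
  let g' : Fin n → ℤˣ := fun i => if x i = 0 then 1 else g i
  have hg' : g' ∈ S := by
    refine Finset.mem_filter.2 ⟨Finset.mem_univ _,
      ⟨x - ε • u.1, L.sub_mem hx (L.smul_mem ε u.2)⟩, fun i => ?_⟩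
    by_cases hxi : x i = 0
    · have h1 := hu i
      rw [hneg i hxi] at h1
      have h2 : u.1 i < 0 := by simpa using h1
      simpa [g', hxi] using mul_neg_of_pos_of_neg hε0 h2
    · simpa [g', hxi] using hε i hxi
  refine absurd (hgmax g' hg') (not_le.2 (Finset.card_lt_card ?_))
  refine Finset.ssubset_iff_of_subset (fun i hi => ?_) |>.2 ⟨i₀, ?_, ?_⟩
  · have hi1 : g i = 1 := (Finset.mem_filter.1 hi).2
    simp [g', hi1]
  · simp [g', hi₀]
  · simp [hneg i₀ hi₀]

end Chamber

/-! ### Cohomology of convex sets and their retracts -/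

section Cone

variable {k : Type*} [CommRing k] {V : Type*} [NormedAddCommGroup V] {s : Set V}

open Classical in
/-- A singular simplex of a set in a vector space, extended by `y` to all of the ambient space of
the standard simplex. -/
noncomputable def SingularSimplex.extend {q : ℕ} (y : V) (σ : SingularSimplex s q)
    (w : Fin q → ℝ) : V :=
  if h : w ∈ stdSimplex ℝ (Fin q) then σ ⟨w, h⟩ else y

theorem SingularSimplex.extend_apply {q : ℕ} (y : V) (σ : SingularSimplex s q) {w : Fin q → ℝ}
    (h : w ∈ stdSimplex ℝ (Fin q)) : σ.extend y w = σ ⟨w, h⟩ := dif_pos h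

theorem SingularSimplex.continuousOn_extend {q : ℕ} (y : V) (σ : SingularSimplex s q) :
    ContinuousOn (σ.extend y) (stdSimplex ℝ (Fin q)) := by
  rw [continuousOn_iff_continuous_domRestrict]
  have : (stdSimplex ℝ (Fin q)).domRestrict (σ.extend y) = fun x => (σ x : V) := by
    funext x
    exact σ.extend_apply y x.2
  rw [this]
  fun_prop

theorem SingularSimplex.exists_norm_extend_le {q : ℕ} (y : V) (σ : SingularSimplex s q) :
    ∃ B, ∀ w, ‖σ.extend y w‖ ≤ B := by
  obtain ⟨B, hB⟩ := (isCompact_univ (X := stdSimplex ℝ (Fin q))).exists_bound_of_continuousOn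
    (f := fun x => (σ x : V)) (by fun_prop)
  refine ⟨max B ‖y‖, fun w => ?_⟩
  by_cases h : w ∈ stdSimplex ℝ (Fin q)
  · rw [σ.extend_apply y h]
    exact (hB _ (Set.mem_univ _)).trans (le_max_left _ _)
  · rw [SingularSimplex.extend, dif_neg h]
    exact le_max_right _ _

/-- The projection of a point of the standard simplex from the vertex `0`. -/
noncomputable def projectFromZero {q : ℕ} (t : stdSimplex ℝ (Fin (q + 1))) : Fin q → ℝ :=
  fun i => t i.succ / (1 - t 0)

theorem projectFromZero_mem {q : ℕ} {t : stdSimplex ℝ (Fin (q + 1))} (ht : t 0 ≠ 1) :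
    projectFromZero t ∈ stdSimplex ℝ (Fin q) := by
  have h1 : 0 ≤ 1 - t 0 := sub_nonneg.2 (stdSimplex.le_one t 0)
  have h2 : 1 - t 0 ≠ 0 := sub_ne_zero.2 ht.symm
  refine ⟨fun i => div_nonneg (stdSimplex.zero_le t _) h1, ?_⟩
  have h3 := stdSimplex.sum_eq_one t
  rw [Fin.sum_univ_succ] at h3
  simp only [projectFromZero]
  rw [← Finset.sum_div, eq_sub_of_add_eq' h3, div_self h2]

variable [NormedSpace ℝ V]

/-- At the apex the projection is a junk value, but the extended simplex is bounded and its factor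
`1 - t 0` tends to 0. For `q = 0` the formula gives the point `y`. -/
theorem continuous_coneFun {q : ℕ} (y : V) (σ : SingularSimplex s q) :
    Continuous fun t : stdSimplex ℝ (Fin (q + 1)) =>
      t 0 • y + (1 - t 0) • σ.extend y (projectFromZero t) := by
  have hcoe : ∀ i : Fin (q + 1), Continuous fun t : stdSimplex ℝ (Fin (q + 1)) => t i :=
    fun i => (continuous_apply i).comp continuous_subtype_val
  refine ((hcoe 0).smul continuous_const).add (continuous_iff_continuousAt.2 fun t => ?_)
  by_cases ht : t 0 = 1
  · obtain ⟨B, hB⟩ := σ.exists_norm_extend_le y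
    rw [ContinuousAt, ht, sub_self, zero_smul]
    refine squeeze_zero_norm (a := fun t : stdSimplex ℝ (Fin (q + 1)) => (1 - t 0) * B)
      (fun t => ?_) ?_
    · rw [norm_smul, Real.norm_of_nonneg (sub_nonneg.2 (stdSimplex.le_one t 0))]
      exact mul_le_mul_of_nonneg_left (hB _) (sub_nonneg.2 (stdSimplex.le_one t 0))
    · have h1 : Continuous fun t : stdSimplex ℝ (Fin (q + 1)) => (1 - t 0) * B :=
        (continuous_const.sub (hcoe 0)).mul continuous_const
      have := h1.tendsto t
      rwa [ht, sub_self, zero_mul] at this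
  · refine ((continuous_const.sub (hcoe 0)).continuousAt).smul ?_
    have h1 := σ.continuousOn_extend y _ (projectFromZero_mem ht)
    refine h1.tendsto.comp (tendsto_nhdsWithin_iff.2 ⟨?_, ?_⟩)
    · refine tendsto_pi_nhds.2 fun i => ?_
      exact ((hcoe i.succ).continuousAt).div ((continuous_const.sub (hcoe 0)).continuousAt)
        (sub_ne_zero.2 (Ne.symm ht))
    · filter_upwards [(isOpen_ne.preimage (hcoe 0)).mem_nhds ht] with t' ht'
      exact projectFromZero_mem ht'

theorem coneFun_mem (hs : Convex ℝ s) (y : s) {q : ℕ} (σ : SingularSimplex s q)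
    (t : stdSimplex ℝ (Fin (q + 1))) :
    t 0 • (y : V) + (1 - t 0) • σ.extend (y : V) (projectFromZero t) ∈ s := by
  by_cases ht : t 0 = 1
  · rw [ht, sub_self, zero_smul, one_smul, add_zero]
    exact y.2
  · rw [σ.extend_apply _ (projectFromZero_mem ht)]
    exact hs y.2 (Subtype.coe_prop _) (stdSimplex.zero_le t 0)
      (sub_nonneg.2 (stdSimplex.le_one t 0)) (by ring)

/-- The cone with apex `y` over a singular simplex of a convex set. -/
noncomputable def SingularSimplex.cone (hs : Convex ℝ s) (y : s) {q : ℕ}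
    (σ : SingularSimplex s q) : SingularSimplex s (q + 1) where
  toFun t := ⟨_, coneFun_mem hs y σ t⟩
  continuous_toFun := (continuous_coneFun _ σ).subtype_mk _

theorem SingularSimplex.cone_apply (hs : Convex ℝ s) (y : s) {q : ℕ} (σ : SingularSimplex s q)
    (t : stdSimplex ℝ (Fin (q + 1))) :
    (σ.cone hs y t : V) = t 0 • (y : V) + (1 - t 0) • σ.extend (y : V) (projectFromZero t) := rfl

theorem SingularSimplex.face_zero_cone (hs : Convex ℝ s) (y : s) {q : ℕ}
    (σ : SingularSimplex s q) : (σ.cone hs y).face 0 = σ := by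
  ext x
  change (σ.cone hs y (stdSimplex.map (Fin.succAbove 0) x) : V) = σ x
  have h1 : projectFromZero (stdSimplex.map (Fin.succAbove 0) x) = x.1 := by
    funext i
    rw [projectFromZero, stdSimplex_map_succAbove_self, ← Fin.succAbove_zero_apply,
      stdSimplex_map_succAbove, sub_zero, div_one]
    rfl
  rw [SingularSimplex.cone_apply, h1, stdSimplex_map_succAbove_self, zero_smul, sub_zero,
    zero_add, one_smul, σ.extend_apply _ x.2]

theorem SingularSimplex.face_succ_cone (hs : Convex ℝ s) (y : s) {q : ℕ}
    (σ : SingularSimplex s (q + 1)) (i : Fin (q + 1)) :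
    (σ.cone hs y).face i.succ = (σ.face i).cone hs y := by
  ext x
  change (σ.cone hs y (stdSimplex.map (Fin.succAbove i.succ) x) : V) = (σ.face i).cone hs y x
  have h0 : stdSimplex.map (Fin.succAbove i.succ) x 0 = x 0 := by
    have := stdSimplex_map_succAbove i.succ x 0
    rwa [Fin.succ_succAbove_zero] at this
  rw [SingularSimplex.cone_apply, SingularSimplex.cone_apply, h0]
  by_cases hx : x 0 = 1
  · simp [hx]
  have hx' : stdSimplex.map (Fin.succAbove i.succ) x 0 ≠ 1 := by rwa [h0]
  rw [σ.extend_apply _ (projectFromZero_mem hx'),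
    (σ.face i).extend_apply _ (projectFromZero_mem hx)]
  congr 2
  change _ = (σ (stdSimplex.map i.succAbove ⟨projectFromZero x, projectFromZero_mem hx⟩) : V)
  congr 2
  apply stdSimplex.ext
  funext j
  change projectFromZero (stdSimplex.map i.succ.succAbove x) j = _
  rw [projectFromZero, h0]
  rcases Fin.eq_self_or_eq_succAbove i j with rfl | ⟨l, rfl⟩
  · rw [stdSimplex_map_succAbove_self, stdSimplex_map_succAbove_self, zero_div]
  · rw [stdSimplex_map_succAbove, ← Fin.succ_succAbove_succ, stdSimplex_map_succAbove]
    rfl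

theorem subsingleton_reducedCohomology_iff {X : Type*} [TopologicalSpace X] {q : ℕ} :
    Subsingleton (ReducedCohomology k X q) ↔
      ∀ φ, singularCoboundary k X q φ = 0 → φ ∈ reducedCoboundaries k X q := by
  rw [Submodule.Quotient.subsingleton_iff, Submodule.eq_top_iff']
  exact ⟨fun h φ hφ => h ⟨φ, hφ⟩, fun h φ => h φ.1 φ.2⟩

/-- Nonempty convex sets have no reduced cohomology. -/
theorem Convex.subsingleton_reducedCohomology (hs : Convex ℝ s) (y : s) (q : ℕ) :
    Subsingleton (ReducedCohomology k s q) := by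
  refine subsingleton_reducedCohomology_iff.2 fun φ hφ => ?_
  have h := fun σ : SingularSimplex s q => congr_fun hφ (σ.cone hs y)
  simp only [singularCoboundary_apply, Fin.sum_univ_succ, SingularSimplex.face_zero_cone,
    Pi.zero_apply, Fin.val_zero, pow_zero, one_mul, Fin.val_succ] at h
  -- In degree -1 a cone has only its base as a face, so the cocycle is zero. In higher degrees
  -- evaluation on cones is a primitive.
  cases q with
  | zero =>
    have : φ = 0 := by
      funext σ
      simpa using h σ
    exact this ▸ Submodule.zero_mem _
  | succ q =>
    refine ⟨fun τ => φ (τ.cone hs y), funext fun σ => ?_⟩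
    have h1 := h σ
    simp only [SingularSimplex.face_succ_cone, pow_succ, mul_neg_one, neg_mul,
      Finset.sum_neg_distrib] at h1
    rw [singularCoboundary_apply]
    exact (sub_eq_zero.1 (by rw [sub_eq_add_neg]; exact h1)).symm

/-- Retracts of spaces without reduced cohomology have no reduced cohomology. -/
theorem subsingleton_reducedCohomology_of_retract {X Y : Type*} [TopologicalSpace X]
    [TopologicalSpace Y] (i : C(X, Y)) (r : C(Y, X)) (hr : ∀ x, r (i x) = x) {q : ℕ}
    (h : Subsingleton (ReducedCohomology k Y q)) : Subsingleton (ReducedCohomology k X q) := by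
  refine subsingleton_reducedCohomology_iff.2 fun φ hφ => ?_
  have hcomp : ∀ {p : ℕ} (σ : SingularSimplex X p), r.comp (i.comp σ) = σ := fun σ =>
    ContinuousMap.ext fun x => hr (σ x)
  have h1 := subsingleton_reducedCohomology_iff.1 h (fun σ => φ (r.comp σ))
    (funext fun σ => congr_fun hφ (r.comp σ))
  cases q with
  | zero =>
    have : φ = 0 := by
      funext σ
      rw [← hcomp σ]
      exact congr_fun ((Submodule.mem_bot k).1 h1) (i.comp σ)
    exact this ▸ Submodule.zero_mem _
  | succ q =>
    obtain ⟨ψ, hψ⟩ := h1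
    refine ⟨fun τ => ψ (i.comp τ), funext fun σ => ?_⟩
    rw [← hcomp σ]
    refine Eq.trans ?_ (congr_fun hψ (i.comp σ))
    rw [hcomp]
    rfl

end Cone

/-! ### The retraction given by a positive vector, and the theorem -/

section Main

variable {k : Type*} [CommRing k] {n : ℕ}

/-- An orthant is a pointed cone: nonnegative contributions in each signed coordinate cannot cancel.
-/
theorem convex_cone_diff_zero (L : Submodule ℝ (EuclideanSpace ℝ (Fin n))) (g : Fin n → ℤˣ) :
    Convex ℝ {x : EuclideanSpace ℝ (Fin n) |
      x ∈ L ∧ (∀ i, 0 ≤ ((g i : ℤ) : ℝ) * x i) ∧ x ≠ 0} := by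
  rintro x ⟨hxL, hx, hx0⟩ z ⟨hzL, hz, hz0⟩ a b ha hb hab
  have hi : ∀ i, ((g i : ℤ) : ℝ) * (a • x + b • z) i =
      a * (((g i : ℤ) : ℝ) * x i) + b * (((g i : ℤ) : ℝ) * z i) := by
    intro i
    simp only [PiLp.add_apply, PiLp.smul_apply, smul_eq_mul]
    ring
  refine ⟨L.add_mem (L.smul_mem _ hxL) (L.smul_mem _ hzL), fun i => ?_, fun h0 => ?_⟩
  · rw [hi]
    exact add_nonneg (mul_nonneg ha (hx i)) (mul_nonneg hb (hz i))
  · have hax : a • x = 0 := by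
      ext i
      have h1 := hi i
      rw [h0, PiLp.zero_apply, mul_zero] at h1
      have h2 := mul_nonneg ha (hx i)
      have h3 := mul_nonneg hb (hz i)
      have h4 : ((g i : ℤ) : ℝ) * (a * x i) = 0 := by
        rw [mul_left_comm]
        linarith
      exact (mul_eq_zero.1 h4).resolve_left (by simp)
    have ha0 : a = 0 := (smul_eq_zero.1 hax).resolve_right hx0
    rw [hax, zero_add] at h0
    have hb0 : b = 0 := (smul_eq_zero.1 h0).resolve_right hz0
    simp [ha0, hb0] at hab

/-- If `L` contains a positive vector, then the Farkas spaces are retracts of convex sets. -/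
theorem subsingleton_reducedCohomology_farkasSpace
    {L : Submodule ℝ (EuclideanSpace ℝ (Fin n))} {v : EuclideanSpace ℝ (Fin n)} (hvL : v ∈ L)
    (hv : ∀ i, 0 < v i) {g : Fin n → ℤˣ} (hg1 : g ≠ 1) (hg2 : g ≠ -1)
    (hne : (closedCell (SignPattern.toPartial g) ∩
      (L : Set (EuclideanSpace ℝ (Fin n)))).Nonempty) (q : ℕ) :
    Subsingleton (ReducedCohomology k (farkasSpace L g) q) := by
  classical
  set s := {x : EuclideanSpace ℝ (Fin n) |
    x ∈ L ∧ (∀ i, 0 ≤ ((g i : ℤ) : ℝ) * x i) ∧ x ≠ 0} with hs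
  obtain ⟨y, hy, hyL⟩ := hne
  rw [mem_closedCell_toPartial] at hy
  obtain ⟨iₚ, hiₚ⟩ : ∃ i, g i = 1 := by
    by_contra! h
    exact hg2 (funext fun i => (Int.units_eq_one_or (g i)).resolve_left (h i))
  obtain ⟨iₙ, hiₙ⟩ : ∃ i, g i = -1 := by
    by_contra! h
    exact hg1 (funext fun i => (Int.units_eq_one_or (g i)).resolve_right (h i))
  let P : Finset (Fin n) := {i | g i = 1}
  have hP : P.Nonempty := ⟨iₚ, by simp [P, hiₚ]⟩
  -- The time at which the first positive-sign coordinate of `x - t • v` vanishes; negative-sign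
  -- coordinates only decrease meanwhile.
  let t : EuclideanSpace ℝ (Fin n) → ℝ := fun x => P.inf' hP fun i => x i / v i
  have ht : Continuous t := by
    refine Continuous.finset_inf'_apply _ fun i _ => ?_
    fun_prop
  have ht0 : ∀ x : EuclideanSpace ℝ (Fin n), (∀ i, 0 ≤ ((g i : ℤ) : ℝ) * x i) → 0 ≤ t x := by
    intro x hx
    refine Finset.le_inf' _ _ fun i hi => div_nonneg ?_ (hv i).le
    have h1 := hx i
    rwa [(Finset.mem_filter.1 hi).2, Units.val_one, Int.cast_one, one_mul] at h1
  let z : EuclideanSpace ℝ (Fin n) → EuclideanSpace ℝ (Fin n) := fun x => x - t x • v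
  have hz : Continuous z := by fun_prop
  have hzi : ∀ x i, z x i = x i - t x * v i := fun x i => rfl
  have hz1 : ∀ x : EuclideanSpace ℝ (Fin n), (∀ i, 0 ≤ ((g i : ℤ) : ℝ) * x i) →
      ∀ i, 0 ≤ ((g i : ℤ) : ℝ) * z x i := by
    intro x hx i
    rcases Int.units_eq_one_or (g i) with h | h
    · have h1 : t x ≤ x i / v i := Finset.inf'_le _ (by simp [P, h])
      rw [le_div_iff₀ (hv i)] at h1
      rw [h, hzi]
      simpa using h1
    · have h1 := hx i
      have h2 := mul_nonneg (ht0 x hx) (hv i).le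
      rw [h] at h1 ⊢
      rw [hzi]
      simp only [Units.val_neg, Units.val_one, Int.cast_neg, Int.cast_one] at h1 ⊢
      linarith
  have hz2 : ∀ x, ∃ i, g i = 1 ∧ z x i = 0 := by
    intro x
    obtain ⟨i, hiP, hi⟩ := Finset.exists_mem_eq_inf' hP fun i => x i / v i
    have hi' : t x = x i / v i := hi
    refine ⟨i, (Finset.mem_filter.1 hiP).2, ?_⟩
    rw [hzi, hi', div_mul_cancel₀ _ (hv i).ne', sub_self]
  -- Otherwise `x` would be a nonnegative multiple of `v`, and the negative sign at `iₙ` forces that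
  -- multiple to be 0.
  have hz0 : ∀ x ∈ s, z x ≠ 0 := by
    rintro x ⟨-, hx, hx0⟩ h0
    have hxe : ∀ i, x i = t x * v i := fun i => by
      have := hzi x i
      rw [h0, PiLp.zero_apply] at this
      linarith
    have h1 := hx iₙ
    rw [hiₙ, hxe] at h1
    simp only [Units.val_neg, Units.val_one, Int.cast_neg, Int.cast_one] at h1
    have h2 : t x = 0 := by
      have h3 := mul_nonneg (ht0 x hx) (hv iₙ).le
      exact (mul_eq_zero.1 (by linarith : t x * v iₙ = 0)).resolve_right (hv iₙ).ne'
    exact hx0 (by ext i; rw [hxe, h2, zero_mul]; rfl)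
  have hmem : ∀ x : farkasSpace L g, x.1 ∈ s := by
    intro x
    obtain ⟨h1, h2, h3, -⟩ := mem_farkasSpace.1 x.2
    exact ⟨h1, h3, fun h => by simp [h] at h2⟩
  let r : C(s, farkasSpace L g) := ⟨fun x => ⟨‖z x‖⁻¹ • z x, by
      have hpos : 0 < ‖z x‖⁻¹ := inv_pos.2 (norm_pos_iff.2 (hz0 x x.2))
      obtain ⟨i, hi, hi0⟩ := hz2 x
      refine mem_farkasSpace.2 ⟨L.smul_mem _ (L.sub_mem x.2.1 (L.smul_mem _ hvL)), ?_,
        fun i => ?_, i, hi, ?_⟩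
      · rw [norm_smul, norm_inv, norm_norm, inv_mul_cancel₀ (norm_ne_zero_iff.2 (hz0 x x.2))]
      · rw [PiLp.smul_apply, smul_eq_mul, mul_left_comm]
        exact mul_nonneg hpos.le (hz1 x x.2.2.1 i)
      · rw [PiLp.smul_apply, hi0, smul_zero]⟩, by
      have h1 : Continuous fun x : s => z x := by fun_prop
      exact ((h1.norm.inv₀ fun x => norm_ne_zero_iff.2 (hz0 x x.2)).smul h1).subtype_mk _⟩
  let ι : C(farkasSpace L g, s) := ⟨fun x => ⟨x.1, hmem x⟩, by fun_prop⟩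
  refine subsingleton_reducedCohomology_of_retract ι r (fun x => Subtype.ext ?_)
    ((convex_cone_diff_zero L g).subsingleton_reducedCohomology
      ⟨y, hyL, hy.2, fun h => by simp [h] at hy⟩ q)
  obtain ⟨-, h1, h2, i, hi, hi0⟩ := mem_farkasSpace.1 x.2
  have h3 : t x = 0 := by
    refine le_antisymm ?_ (ht0 x h2)
    have h4 : t x ≤ x.1 i / v i := Finset.inf'_le _ (by simp [P, hi])
    simpa [hi0] using h4
  have h4 : z x = x := by simp [z, h3]
  change ‖z x‖⁻¹ • z x = x
  rw [h4, h1, inv_one, one_smul]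

end Main

theorem mainTheorem2 (k : Type*) [CommRing k] [Nontrivial k] (n : ℕ)
    (L : Submodule ℝ (EuclideanSpace ℝ (Fin n)))
    (hdim : 2 ≤ Module.finrank ℝ L)
    (hcoord : ∀ i : Fin n, ∃ x ∈ L, x i ≠ 0) :
    (∃ x ∈ L, ∀ i, 0 < x i) ↔
      ∀ g : Fin n → ℤˣ, g ≠ 1 → g ≠ -1 →
        (closedCell (SignPattern.toPartial g) ∩ (L : Set (EuclideanSpace ℝ (Fin n)))).Nonempty →
        ∀ q : ℕ, Subsingleton (ReducedCohomology k (farkasSpace L g) q) := by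
  constructor
  · rintro ⟨v, hvL, hv⟩ g hg1 hg2 hne q
    exact subsingleton_reducedCohomology_farkasSpace hvL hv hg1 hg2 hne q
  · intro h
    by_contra hpos
    obtain ⟨g, u, hu, hg⟩ := exists_chamber hcoord
    obtain ⟨q, hq⟩ := exists_not_subsingleton_reducedCohomology (k := k) L hdim g u hu hg
    have hu0 : u.1 ≠ 0 := by
      intro h0
      have hn : ∀ i : Fin n, False := fun i => by simpa [h0] using hu i
      have : IsEmpty (Fin n) := ⟨hn⟩
      have : Module.finrank ℝ L = 0 := Module.finrank_zero_of_subsingleton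
      omega
    refine hq (h g ?_ ?_ ⟨‖u.1‖⁻¹ • u.1, ?_, L.smul_mem _ u.2⟩ q)
    · rintro rfl
      exact hpos ⟨u, u.2, fun i => by simpa using hu i⟩
    · rintro rfl
      -- The all-negative chamber is excluded because its antipode would be positive.
      exact hpos ⟨-u.1, L.neg_mem u.2, fun i => by simpa using hu i⟩
    · refine (mem_closedCell_toPartial g _).2 ⟨?_, fun i => ?_⟩
      · rw [norm_smul, norm_inv, norm_norm, inv_mul_cancel₀ (norm_ne_zero_iff.2 hu0)]
      · rw [PiLp.smul_apply, smul_eq_mul, mul_left_comm]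
        exact mul_nonneg (inv_nonneg.2 (norm_nonneg _)) (hu i).le
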